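/- For $U:\mathbb Z\to\mathbb R$, the Zig-Zag (persistent) walk on $\mathbb Z$ associated to $U$ is the Markov chain $(X_k,V_k)_{k\in\mathbb N}$ on $\mathbb Z\times\{-1,1\}$ which from $(x,v)$ goes to $(x+v,v)$ with probability $\min\left(e^{-U(x+v)}/e^{-U(x)},1\right)$ and to $(x,-v)$ otherwise. For $H\in\mathcal C^1(\mathbb R)$, the Zig-Zag (telegraph) process on $\mathbb R$ associated to $H$ is the càdlàg Markov process on $\mathbb R\times\{-1,1\}$ with generator \[ Lf(y,w)=w\,\partial_y f(y,w)+\left(wH'(y)\right)_+\left(f(y,-w)-f(y,w)\right),\] i.e. the piecewise deterministic process that, started from $(y,w)$, follows $(Y_t,W_t)=(y+tw,w)$ up to a random time $T\in(0,\infty]$ with $\mathbb P(T>t)=\exp\left(-\int_0^t (wH'(y+sw))_+\,ds\right)$ for all $t\geqslant 0$, jumps to $(y+Tw,-w)$ at time $T$, and then starts afresh from there in the same way. Theorem. Let $H\in\mathcal C^2(\mathbb R)$ be such that $H(x)\to+\infty$ as $|x|\to\infty$. For all $\varepsilon>0$, let $U_\varepsilon(k)=H(\varepsilon k)$ for $k\in\mathbb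 Z$, and let $(X^\varepsilon_k,V^\varepsilon_k)_{k\in\mathbb N}$ be a Zig-Zag walk on $\mathbb Z$ associated to $U_\varepsilon$ with initial condition $(x_0^\varepsilon,v_0)\in\mathbb Z\times\{-1,1\}$, where $v_0$ does not depend on $\varepsilon$. Suppose that $\varepsilon x_0^\varepsilon\to x_0^*\in\mathbb R$ as $\varepsilon\to0$. Let $(Y_t,W_t)_{t\geqslant0}$ be a Zig-Zag process on $\mathbb R$ associated to $H$ with $(Y_0,W_0)=(x_0^*,v_0)$. Then, as $\varepsilon\to0$, \[\left(\varepsilon X^\varepsilon_{\lfloor t/\varepsilon\rfloor},V^\varepsilon_{\lfloor t/\varepsilon\rfloor}\right)_{t\geqslant0}\ \longrightarrow\ (Y_t,W_t)_{t\geqslant0}\] in law, for the Skorokhod ($J_1$) topology on càdlàg functions from $[0,\infty)$ to $\mathbb R^2$. -/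

import Mathlib

open MeasureTheory Filter Set
open scoped NNReal ENNReal Topology

/-! ### Càdlàg paths and the Skorokhod topology -/

/-- Càdlàg functions from `[0, ∞)` to `E`: right-continuous with left limits. -/
structure Cadlag (E : Type*) [TopologicalSpace E] where
  toFun : ℝ≥0 → E
  right_continuous : ∀ t, ContinuousWithinAt toFun (Ici t) t
  left_limit : ∀ t, ∃ l, Tendsto toFun (𝓝[<] t) (𝓝 l)

namespace Cadlag

instance {E : Type*} [TopologicalSpace E] : CoeFun (Cadlag E) (fun _ => ℝ≥0 → E) := ⟨toFun⟩

variable {E : Type*} [PseudoMetricSpace E]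

/-- The pairs `(x, y)` of càdlàg paths for which some increasing time change `γ` of `[0, ∞)` onto
itself (automatically continuous, with `γ 0 = 0`) satisfies `|γ t - t| < δ` and
`d (y (γ t), x t) < δ` for all `t ∈ [0, T]`. -/
def entourage (E : Type*) [PseudoMetricSpace E] (T : ℝ≥0) (δ : ℝ) : Set (Cadlag E × Cadlag E) :=
  {p | ∃ γ : ℝ≥0 ≃o ℝ≥0, ∀ t ≤ T, dist (γ t) t < δ ∧ dist (p.2 (γ t)) (p.1 t) < δ}

theorem entourage_mono {T T' : ℝ≥0} {δ δ' : ℝ} (hT : T' ≤ T) (hδ : δ ≤ δ') :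
    entourage E T δ ⊆ entourage E T' δ' := by
  rintro p ⟨γ, h⟩
  exact ⟨γ, fun t ht => ⟨(h t (ht.trans hT)).1.trans_le hδ, (h t (ht.trans hT)).2.trans_le hδ⟩⟩

theorem le_of_apply_le {γ : ℝ≥0 ≃o ℝ≥0} {T : ℝ≥0}
    (h : dist (γ (T + 1)) (T + 1) < 1) {s : ℝ≥0} (hs : γ s ≤ T) : s ≤ T + 1 := by
  refine γ.le_iff_le.1 (hs.trans ?_)
  rw [NNReal.dist_eq, abs_lt] at h
  have h1 := h.1
  rw [← NNReal.coe_le_coe]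
  push_cast at h1
  linarith

/-- The sets `entourage E T δ`, `T ≥ 0`, `δ > 0`, form a basis of a uniform structure. -/
def filterBasis (E : Type*) [PseudoMetricSpace E] : FilterBasis (Cadlag E × Cadlag E) where
  sets := {s | ∃ (T : ℝ≥0) (δ : ℝ), 0 < δ ∧ s = entourage E T δ}
  nonempty := ⟨_, 0, 1, one_pos, rfl⟩
  inter_sets := by
    rintro _ _ ⟨T, δ, hδ, rfl⟩ ⟨T', δ', hδ', rfl⟩
    exact ⟨_, ⟨max T T', min δ δ', lt_min hδ hδ', rfl⟩, subset_inter
      (entourage_mono (le_max_left _ _) (min_le_left _ _))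
      (entourage_mono (le_max_right _ _) (min_le_right _ _))⟩

/-- The Skorokhod (J1) uniform structure on càdlàg paths. In the induced topology, the sets
`{y | (x, y) ∈ entourage E T δ}`, `T ≥ 0`, `δ > 0`, form a basis of neighbourhoods of `x`. -/
instance : UniformSpace (Cadlag E) := .ofCore <| .mkOfBasis (filterBasis E)
  (by
    rintro _ ⟨T, δ, hδ, rfl⟩ x
    exact ⟨OrderIso.refl _, fun t _ => by simp [hδ]⟩)
  (by
    rintro _ ⟨T, δ, hδ, rfl⟩
    refine ⟨_, ⟨T + 1, min δ 1, lt_min hδ one_pos, rfl⟩, ?_⟩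
    rintro ⟨x, y⟩ ⟨γ, h⟩
    refine ⟨γ.symm, fun t ht => ?_⟩
    have hs : γ.symm t ≤ T + 1 :=
      le_of_apply_le ((h _ le_rfl).1.trans_le (min_le_right _ _)) (by simpa using ht)
    obtain ⟨h1, h2⟩ := h _ hs
    rw [OrderIso.apply_symm_apply] at h1 h2
    rw [dist_comm] at h1 h2
    exact ⟨h1.trans_le (min_le_left _ _), h2.trans_le (min_le_left _ _)⟩)
  (by
    rintro _ ⟨T, δ, hδ, rfl⟩
    refine ⟨_, ⟨T + 1, min (δ / 2) 1, lt_min (half_pos hδ) one_pos, rfl⟩, ?_⟩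
    rintro ⟨x, z⟩ ⟨y, ⟨γ, hγ⟩, ⟨η, hη⟩⟩
    refine ⟨γ.trans η, fun t ht => ?_⟩
    obtain ⟨h1, h2⟩ := hγ t (ht.trans (by simp))
    have hs : γ t ≤ T + 1 := by
      have h3 := h1.trans_le (min_le_right _ _)
      rw [NNReal.dist_eq, abs_lt] at h3
      have ht' : (t : ℝ) ≤ T := by exact_mod_cast ht
      rw [← NNReal.coe_le_coe]
      push_cast
      linarith [h3.2]
    obtain ⟨h3, h4⟩ := hη _ hs
    have hle := min_le_left (δ / 2) 1
    simp only [OrderIso.trans_apply] at *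
    exact ⟨(dist_triangle _ (γ t) _).trans_lt (by linarith),
      (dist_triangle _ (y (γ t)) _).trans_lt (by linarith)⟩)

instance : MeasurableSpace (Cadlag E) := borel _

instance : BorelSpace (Cadlag E) := ⟨rfl⟩

/-- The piecewise constant path `t ↦ f ⌊t / ε⌋`. -/
noncomputable def ofSeq {ε : ℝ} (hε : 0 < ε) (f : ℕ → E) : Cadlag E where
  toFun t := f ⌊(t : ℝ) / ε⌋₊
  right_continuous t := by
    have h1 : Tendsto (fun s : ℝ≥0 => (s : ℝ) / ε) (𝓝[≥] t) (𝓝[≥] ((t : ℝ) / ε)) := by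
      refine tendsto_nhdsWithin_iff.2 ⟨?_, ?_⟩
      · exact ((NNReal.continuous_coe.div_const ε).tendsto t).mono_left nhdsWithin_le_nhds
      · filter_upwards [self_mem_nhdsWithin] with s hs
        exact div_le_div_of_nonneg_right (by exact_mod_cast hs) hε.le
    have h2 := tendsto_pure.1 ((tendsto_floor_right_pure_floor ((t : ℝ) / ε)).comp h1)
    refine tendsto_const_nhds.congr' ?_
    filter_upwards [h2] with s hs
    have h3 : ⌊(s : ℝ) / ε⌋ = ⌊(t : ℝ) / ε⌋ := hs
    rw [← Int.floor_toNat, ← Int.floor_toNat, h3]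
  left_limit t := by
    have h1 : Tendsto (fun s : ℝ≥0 => (s : ℝ) / ε) (𝓝[<] t) (𝓝[<] ((t : ℝ) / ε)) := by
      refine tendsto_nhdsWithin_iff.2 ⟨?_, ?_⟩
      · exact ((NNReal.continuous_coe.div_const ε).tendsto t).mono_left nhdsWithin_le_nhds
      · filter_upwards [self_mem_nhdsWithin] with s hs
        exact div_lt_div_of_pos_right (by exact_mod_cast hs) hε
    have h2 := tendsto_pure.1 ((tendsto_floor_left_pure_ceil_sub_one ((t : ℝ) / ε)).comp h1)
    refine ⟨f (⌈(t : ℝ) / ε⌉ - 1).toNat, tendsto_const_nhds.congr' ?_⟩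
    filter_upwards [h2] with s hs
    have h3 : ⌊(s : ℝ) / ε⌋ = ⌈(t : ℝ) / ε⌉ - 1 := hs
    rw [← Int.floor_toNat, h3]

end Cadlag

/-! ### The Zig-Zag (persistent) walk on `ℤ`

Velocities are elements of `ℤˣ = {-1, 1}`. -/

/-- The probability `min (π (x + v) / π x, 1)` of moving from `x` to `x + v`, where `π` is
proportional to `exp (-U)`. -/
noncomputable def walkAccept (U : ℤ → ℝ) (x : ℤ) (v : ℤˣ) : ℝ :=
  min (Real.exp (-U (x + v)) / Real.exp (-U x)) 1

/-- The transition probabilities of the Zig-Zag walk: from `(x, v)`, go to `(x + v, v)` with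
probability `walkAccept U x v`, else to `(x, -v)`. -/
noncomputable def walkTransition (U : ℤ → ℝ) (p q : ℤ × ℤˣ) : ℝ :=
  if q = (p.1 + p.2, p.2) then walkAccept U p.1 p.2
  else if q = (p.1, -p.2) then 1 - walkAccept U p.1 p.2
  else 0

/-- `Z` is a Markov chain on `ℤ × {-1, 1}` started at `(x₀, v₀)` with the transition probabilities
of the Zig-Zag walk associated to `U`. -/
structure IsZigZagWalk {Ω : Type*} [MeasurableSpace Ω] (P : Measure Ω) (U : ℤ → ℝ)
    (x₀ : ℤ) (v₀ : ℤˣ) (Z : ℕ → Ω → ℤ × ℤˣ) : Prop where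
  measurable : ∀ k, Measurable (Z k)
  initial : ∀ᵐ ω ∂P, Z 0 ω = (x₀, v₀)
  markov : ∀ (n : ℕ) (s : ℕ → ℤ × ℤˣ),
    P.real {ω | ∀ k ≤ n + 1, Z k ω = s k} =
      P.real {ω | ∀ k ≤ n, Z k ω = s k} * walkTransition U (s n) (s (n + 1))

/-- The rescaled path `t ↦ (ε X_{⌊t/ε⌋}, V_{⌊t/ε⌋})`, in `ℝ × ℝ`. -/
noncomputable def scaledPath {ε : ℝ} (hε : 0 < ε) (z : ℕ → ℤ × ℤˣ) : Cadlag (ℝ × ℝ) :=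
  Cadlag.ofSeq hε fun k => (ε * ((z k).1 : ℝ), (((z k).2 : ℤ) : ℝ))

/-! ### The Zig-Zag process on `ℝ` -/

/-- The velocity after `n` flips. -/
def flipVelocity (w₀ : ℤˣ) (n : ℕ) : ℝ := ((((-1) ^ n * w₀ : ℤˣ) : ℤ) : ℝ)

/-- `exp (-∫₀ᵗ (w H'(y + s w))₊ ds)`: the probability that the Zig-Zag process, started at
`(y, w)`, does not jump before or at time `t`. -/
noncomputable def noJumpProb (H : ℝ → ℝ) (y w : ℝ) (t : ℝ≥0) : ℝ :=
  Real.exp (-∫ s in (0 : ℝ)..t, max (w * deriv H (y + s * w)) 0)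

/-- `Z = (Y, W)` is a Zig-Zag process associated to `H` started at `(y₀, w₀)`, described as a
piecewise deterministic Markov process: there are jump times `0 = J₀ < J₁ < ⋯`, possibly infinite
from some index on, such that between two of them the process follows the flow
`(y, w) ↦ (y + t w, w)`, the velocity is reversed at each of them, `Y` is continuous, and the
holding time `J (n + 1) - J n` has, given `J 0, …, J n` (that is, given the path up to time `J n`,
the initial state being deterministic), the survival function `noJumpProb H (Y (J n)) (W (J n))`. -/
def IsZigZagProcess {Ω : Type*} [MeasurableSpace Ω] (P : Measure Ω) (H : ℝ → ℝ)
    (y₀ : ℝ) (w₀ : ℤˣ) (Z : Ω → Cadlag (ℝ × ℝ)) : Prop :=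
  ∃ J : ℕ → Ω → ℝ≥0∞,
    (∀ n, Measurable (J n)) ∧
    (∀ᵐ ω ∂P, J 0 ω = 0 ∧ Monotone (fun n => J n ω)) ∧
    (∀ᵐ ω ∂P, (Z ω 0).1 = y₀) ∧
    (∀ᵐ ω ∂P, ∀ (n : ℕ) (t : ℝ≥0), J n ω ≤ t → t ≤ J (n + 1) ω →
      (Z ω t).1 = (Z ω (J n ω).toNNReal).1 + (t - (J n ω).toNNReal) * flipVelocity w₀ n) ∧
    (∀ᵐ ω ∂P, ∀ (n : ℕ) (t : ℝ≥0), J n ω ≤ t → t < J (n + 1) ω →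
      (Z ω t).2 = flipVelocity w₀ n) ∧
    (∀ (n : ℕ) (t : ℝ≥0) (B : Set (Fin (n + 1) → ℝ≥0∞)), MeasurableSet B →
      P {ω | (fun i : Fin (n + 1) => J i ω) ∈ B ∧ J n ω + t < J (n + 1) ω} =
        ∫⁻ ω in {ω | (fun i : Fin (n + 1) => J i ω) ∈ B ∧ J n ω < ∞},
          ENNReal.ofReal
            (noJumpProb H (Z ω (J n ω).toNNReal).1 (flipVelocity w₀ n) t) ∂P)

open ProbabilityTheory

/-! ### Skorokhod convergence and deformations of time. -/

namespace Cadlag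

section Topology

variable {E : Type*} [PseudoMetricSpace E]

/-! The walks for all `ε` and the limit process can be built from one sequence of independent
standard exponential clocks, and the convergence then holds almost surely. An exponential clock that
has survived so far survives a further increment `r` with probability `exp (-r)`, and the walk
accepts a move with exactly this probability for `r = (U (x + v) - U x)₊`. So the walk may be run by
adding up these increments and flipping when the current clock is exhausted. The process on `ℝ` does
the same with the integrated rate `(w H')₊`.

Both constructions have the right law. For the walk this is memorylessness
(`isZigZagWalk_walkState`) and the fact that a Markov chain is determined by its initial state and
transitions (`IsZigZagWalk.map_eq`). For the process, the holding laws determine the law of the jump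
times, and the path is a function of these (`IsZigZagProcess.map_eq`).

For fixed clocks, uniform continuity of `H'` on compact sets makes the discrete rate a Riemann sum
of the continuous one (`tendsto_walkHazard`). The number of moves before a flip is a generalized
inverse of this rate. It converges after rescaling unless the limit rate has a plateau exactly at
the level of the clock, an event of probability zero (`ae_hazard_ne`). By induction all flip times
and positions converge (`tendsto_flipState`). Since `H` tends to infinity, the holding times are
finite; since the speed is one and the rate is locally bounded, jumps do not accumulate
(`isJumpSeq_clockJump`). Matching the flips by a small change of time gives Skorokhod convergence
(`tendsto_zigzagPath`), and dominated convergence for bounded continuous test functions concludes.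
-/

theorem ext_of_forall {x y : Cadlag E} (h : ∀ t, x t = y t) : x = y := by
  cases x; cases y
  congr
  exact funext h

theorem hasBasis_uniformity :
    (uniformity (Cadlag E)).HasBasis (fun p : ℝ≥0 × ℝ => 0 < p.2)
      fun p => entourage E p.1 p.2 := by
  refine ⟨fun s => ?_⟩
  have h : s ∈ uniformity (Cadlag E) ↔ ∃ t ∈ filterBasis E, t ⊆ s :=
    (filterBasis E).mem_filter_iff
  rw [h]
  constructor
  · rintro ⟨_, ⟨T, δ, hδ, rfl⟩, hs⟩
    exact ⟨(T, δ), hδ, hs⟩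
  · rintro ⟨⟨T, δ⟩, hδ, hs⟩
    exact ⟨_, ⟨T, δ, hδ, rfl⟩, hs⟩

theorem tendsto_nhds_iff {ι : Type*} {l : Filter ι} {Z : ι → Cadlag E} {x : Cadlag E} :
    Tendsto Z l (𝓝 x) ↔
      ∀ (T : ℝ≥0) (δ : ℝ), 0 < δ → ∀ᶠ i in l, (x, Z i) ∈ entourage E T δ := by
  rw [(nhds_basis_uniformity' hasBasis_uniformity).tendsto_right_iff]
  exact ⟨fun h T δ hδ => h (T, δ) hδ, fun h p hp => h p.1 p.2 hp⟩

/-- On `[0, T]` the path reads only finitely many terms of the sequence, so no change of time is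
needed. -/
theorem continuous_ofSeq {ε : ℝ} (hε : 0 < ε) :
    Continuous (ofSeq hε : (ℕ → E) → Cadlag E) := by
  rw [continuous_iff_continuousAt]
  intro f
  refine tendsto_nhds_iff.2 fun T δ hδ => ?_
  have h : ∀ᶠ g in 𝓝 f, ∀ k ∈ Finset.range (⌊(T : ℝ) / ε⌋₊ + 1), dist (g k) (f k) < δ := by
    rw [Finset.eventually_all]
    intro k _
    exact ((continuous_apply k).tendsto f).eventually (Metric.ball_mem_nhds _ hδ)
  filter_upwards [h] with g hg
  refine ⟨OrderIso.refl _, fun t ht => ⟨by simpa using hδ, ?_⟩⟩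
  refine hg _ (Finset.mem_range_succ_iff.2 (Nat.floor_mono ?_))
  exact div_le_div_of_nonneg_right (by exact_mod_cast ht) hε.le

end Topology

/-- If finitely many instants `a i` are moved by little, the time scale can be deformed
accordingly by little. -/
theorem exists_timeChange {a : ℕ → ℝ≥0} (ha0 : a 0 = 0) (ha : StrictMono a) (N : ℕ) {δ : ℝ}
    (hδ : 0 < δ) : ∃ η > 0, ∀ b : ℕ → ℝ≥0, b 0 = 0 → (∀ i ≤ N, dist (b i) (a i) < η) →
      ∃ γ : ℝ≥0 ≃o ℝ≥0, (∀ i ≤ N, γ (a i) = b i) ∧ ∀ t, dist (γ t) t < δ := by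
  -- `ρ` is a positive lower bound for the gaps between the instants `a 0, …, a N`.
  obtain ⟨ρ, hρ, hρ0⟩ : ∃ ρ : ℝ, (∀ p ∈ Finset.range (N + 1) ×ˢ Finset.range (N + 1),
      p.1 ≠ p.2 → ρ ≤ |(a p.1 : ℝ) - a p.2|) ∧ 0 < ρ := by
    have h : ∀ᶠ ρ in 𝓝[>] (0 : ℝ), ∀ p ∈ Finset.range (N + 1) ×ˢ Finset.range (N + 1),
        p.1 ≠ p.2 → ρ ≤ |(a p.1 : ℝ) - a p.2| := by
      rw [Finset.eventually_all]
      rintro ⟨i, j⟩ _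
      by_cases hij : i = j
      · simp [hij]
      · have : 0 < |(a i : ℝ) - a j| := by
          rw [abs_pos, sub_ne_zero]
          exact fun h => hij (ha.injective (NNReal.coe_injective h))
        filter_upwards [nhdsWithin_le_nhds (Iic_mem_nhds this)] with ρ hρ _ using hρ
    exact (h.and self_mem_nhdsWithin).exists
  have hN : (0 : ℝ) < N + 1 := by positivity
  -- The bound `ρ / 2` will make the perturbation of the identity `1/2`-Lipschitz, and `δ / 2` will
  -- make it smaller than `δ`. The factor `N + 1` pays for a crude sum over all instants, as
  -- neighbouring tents may overlap.
  set η : ℝ := min (ρ / 2) (δ / 2) / (N + 1) with hη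
  have hη0 : 0 < η := by positivity
  have hηρ : (N + 1) * η ≤ ρ / 2 := by
    rw [hη, mul_div_cancel₀ _ hN.ne']; exact min_le_left _ _
  have hηδ : (N + 1) * η ≤ δ / 2 := by
    rw [hη, mul_div_cancel₀ _ hN.ne']; exact min_le_right _ _
  refine ⟨η, hη0, fun b hb0 hb => ?_⟩
  let tent : ℕ → ℝ → ℝ := fun i t => max (1 - |t - a i| / ρ) 0
  have tent_nonneg : ∀ i t, 0 ≤ tent i t := fun i t => le_max_right _ _
  have tent_le : ∀ i t, tent i t ≤ 1 := fun i t =>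
    max_le (sub_le_self _ (by positivity)) zero_le_one
  have tent_lip : ∀ i s t, |tent i t - tent i s| ≤ |t - s| / ρ := by
    intro i s t
    refine (abs_max_sub_max_le_abs _ _ _).trans ?_
    have : (1 - |t - a i| / ρ) - (1 - |s - a i| / ρ) = (|s - a i| - |t - a i|) / ρ := by ring
    rw [this, abs_div, abs_of_pos hρ0]
    refine div_le_div_of_nonneg_right ?_ hρ0.le
    refine (abs_abs_sub_abs_le_abs_sub (s - a i) (t - a i)).trans (le_of_eq ?_)
    rw [abs_sub_comm]; congr 1; ring
  have tent_self : ∀ i, tent i (a i) = 1 := fun i => by simp [tent]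
  have tent_ne : ∀ i ≤ N, ∀ j ≤ N, i ≠ j → tent i (a j) = 0 := by
    intro i hi j hj hij
    have := hρ (j, i) (by simp; omega) hij.symm
    simp only [tent]
    refine max_eq_right ?_
    have : 1 ≤ |(a j : ℝ) - a i| / ρ := by rwa [le_div_iff₀ hρ0, one_mul]
    linarith
  -- Each tent is `1` at its own instant and `0` at the others, so `t + ψ t` sends `a i` to `b i`.
  let ψ : ℝ → ℝ := fun t => ∑ i ∈ Finset.range (N + 1), ((b i : ℝ) - a i) * tent i t
  have hba : ∀ i ∈ Finset.range (N + 1), |(b i : ℝ) - a i| ≤ η := fun i hi =>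
    (hb i (Finset.mem_range_succ_iff.1 hi)).le
  have ψ_bound : ∀ t, |ψ t| ≤ δ / 2 := by
    intro t
    refine (Finset.abs_sum_le_sum_abs _ _).trans (le_trans ?_ hηδ)
    refine (Finset.sum_le_card_nsmul _ _ η fun i hi => ?_).trans (by simp)
    rw [abs_mul, abs_of_nonneg (tent_nonneg i t)]
    exact (mul_le_mul (hba i hi) (tent_le i t) (tent_nonneg i t) hη0.le).trans (by simp)
  have ψ_lip : ∀ s t, |ψ t - ψ s| ≤ |t - s| / 2 := by
    intro s t
    simp only [ψ]
    rw [← Finset.sum_sub_distrib]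
    refine (Finset.abs_sum_le_sum_abs _ _).trans ?_
    refine (Finset.sum_le_card_nsmul _ _ (η * (|t - s| / ρ)) fun i hi => ?_).trans ?_
    · rw [← mul_sub, abs_mul]
      exact mul_le_mul (hba i hi) (tent_lip i s t) (abs_nonneg _) hη0.le
    · rw [Finset.card_range, nsmul_eq_mul, ← mul_assoc]
      push_cast
      calc (N + 1) * η * (|t - s| / ρ) ≤ ρ / 2 * (|t - s| / ρ) := by gcongr
        _ = |t - s| / 2 := by field_simp
  have ψ_apply : ∀ j ≤ N, ψ (a j) = b j - a j := by
    intro j hj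
    simp only [ψ]
    rw [Finset.sum_eq_single j, tent_self, mul_one]
    · intro i hi hij
      rw [tent_ne i (Finset.mem_range_succ_iff.1 hi) j hj hij, mul_zero]
    · intro h; exact absurd (Finset.mem_range_succ_iff.2 hj) h
  have ψ_zero : ψ 0 = 0 := by simpa [ha0, hb0] using ψ_apply 0 (Nat.zero_le _)
  have hmono : StrictMono fun t => t + ψ t := by
    intro s t hst
    have := (abs_le.1 (ψ_lip s t)).1
    rw [abs_of_pos (sub_pos.2 hst)] at this
    simp only
    linarith
  have hcont : Continuous fun t => t + ψ t := by
    simp only [ψ, tent]; fun_prop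
  have hnonneg : ∀ t : ℝ≥0, 0 ≤ (t : ℝ) + ψ t := fun t => by
    have := hmono.monotone t.2
    simp only [ψ_zero, add_zero] at this
    exact this
  let g : ℝ≥0 → ℝ≥0 := fun t => ⟨t + ψ t, hnonneg t⟩
  have hg : StrictMono g := fun s t hst => by
    rw [← NNReal.coe_lt_coe]
    exact hmono (NNReal.coe_lt_coe.2 hst)
  have hsurj : Function.Surjective g := by
    intro y
    -- Since `ψ ≥ -δ / 2`, the point `y + δ` is sent beyond `y`.
    have hy : (y : ℝ) ∈ Icc ((0 : ℝ) + ψ 0) ((y + δ) + ψ (y + δ)) := by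
      have := (abs_le.1 (ψ_bound (y + δ))).1
      refine ⟨by simp [ψ_zero], by linarith⟩
    obtain ⟨t, ht, hty⟩ := intermediate_value_Icc (by positivity) hcont.continuousOn hy
    exact ⟨⟨t, ht.1⟩, NNReal.coe_injective hty⟩
  refine ⟨hg.orderIsoOfSurjective g hsurj, fun i hi => ?_, fun t => ?_⟩
  · refine NNReal.coe_injective ?_
    change (a i : ℝ) + ψ (a i) = b i
    rw [ψ_apply i hi]; ring
  · change |((t : ℝ) + ψ t) - t| < δ
    rw [add_sub_cancel_left]
    exact (ψ_bound t).trans_lt (by linarith)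

end Cadlag

/-! ### Zig-Zag paths with prescribed jump times -/

/-- Strictly increasing sequences of jump times, starting from `0` and unbounded. -/
def IsJumpSeq (j : ℕ → ℝ≥0) : Prop :=
  j 0 = 0 ∧ (∀ n, j n < j (n + 1)) ∧ ∀ M : ℕ, ∃ n, (M : ℝ≥0) < j n

theorem IsJumpSeq.strictMono {j : ℕ → ℝ≥0} (hj : IsJumpSeq j) : StrictMono j :=
  strictMono_nat_of_lt_succ hj.2.1

theorem IsJumpSeq.exists_lt {j : ℕ → ℝ≥0} (hj : IsJumpSeq j) (t : ℝ≥0) : ∃ n, t < j n := by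
  obtain ⟨M, hM⟩ := exists_nat_gt t
  obtain ⟨n, hn⟩ := hj.2.2 M
  exact ⟨n, hM.trans hn⟩

/-- The number of jumps up to time `t`. -/
noncomputable def jumpCount (j : ℕ → ℝ≥0) (t : ℝ≥0) : ℕ := sInf {n | t < j (n + 1)}

theorem jumpCount_eq {j : ℕ → ℝ≥0} (hj : StrictMono j) {n : ℕ} {t : ℝ≥0} (h1 : j n ≤ t)
    (h2 : t < j (n + 1)) : jumpCount j t = n := by
  refine le_antisymm (Nat.sInf_le h2) ?_
  refine le_csInf ⟨n, h2⟩ fun m hm => ?_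
  have := hj.lt_iff_lt.1 (h1.trans_lt hm)
  omega

theorem IsJumpSeq.exists_index {j : ℕ → ℝ≥0} (hj : IsJumpSeq j) (t : ℝ≥0) :
    ∃ n, j n ≤ t ∧ t < j (n + 1) := by
  have hne : ∃ n, t < j n := hj.exists_lt t
  classical
  obtain ⟨m, hm⟩ : ∃ m, Nat.find hne = m + 1 := by
    refine Nat.exists_eq_succ_of_ne_zero fun h => ?_
    have := Nat.find_spec hne
    rw [h, hj.1] at this
    exact not_lt_bot this
  refine ⟨m, ?_, hm ▸ Nat.find_spec hne⟩
  exact not_lt.1 (Nat.find_min hne (by omega))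

/-- The half-open intervals are closed on the right here because this serves the left limits of the
path. -/
theorem IsJumpSeq.exists_index_left {j : ℕ → ℝ≥0} (hj : IsJumpSeq j) {t : ℝ≥0} (ht : t ≠ 0) :
    ∃ n, j n < t ∧ t ≤ j (n + 1) := by
  obtain ⟨n, h1, h2⟩ := hj.exists_index t
  rcases h1.lt_or_eq with h | h
  · exact ⟨n, h, h2.le⟩
  · obtain ⟨m, rfl⟩ : ∃ m, n = m + 1 := by
      refine Nat.exists_eq_succ_of_ne_zero fun hn => ht ?_
      rw [← h, hn, hj.1]
    exact ⟨m, h ▸ hj.2.1 m, h.ge⟩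

/-- The position at the `n`-th jump of the Zig-Zag path started at `(y₀, w₀)` with jump
times `j`. -/
noncomputable def jumpPos (y₀ : ℝ) (w₀ : ℤˣ) (j : ℕ → ℝ≥0) : ℕ → ℝ
  | 0 => y₀
  | n + 1 => jumpPos y₀ w₀ j n + ((j (n + 1) : ℝ) - j n) * flipVelocity w₀ n

theorem continuous_jumpPos (y₀ : ℝ) (w₀ : ℤˣ) (n : ℕ) :
    Continuous fun j => jumpPos y₀ w₀ j n := by
  induction n with
  | zero => exact continuous_const
  | succ n ih =>
    simp only [jumpPos]
    fun_prop

theorem jumpPos_congr (y₀ : ℝ) (w₀ : ℤˣ) {j j' : ℕ → ℝ≥0} {n : ℕ} (h : ∀ i ≤ n, j i = j' i) :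
    jumpPos y₀ w₀ j n = jumpPos y₀ w₀ j' n := by
  induction n with
  | zero => rfl
  | succ n ih =>
    simp only [jumpPos]
    rw [ih fun i hi => h i (by omega), h _ le_rfl, h n (by omega)]

/-- The Zig-Zag path started at `(y₀, w₀)` with jump times `j`. -/
noncomputable def zigzagFun (y₀ : ℝ) (w₀ : ℤˣ) (j : ℕ → ℝ≥0) (t : ℝ≥0) : ℝ × ℝ :=
  (jumpPos y₀ w₀ j (jumpCount j t) +
    ((t : ℝ) - j (jumpCount j t)) * flipVelocity w₀ (jumpCount j t),
    flipVelocity w₀ (jumpCount j t))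

theorem zigzagFun_eq (y₀ : ℝ) (w₀ : ℤˣ) {j : ℕ → ℝ≥0} (hj : StrictMono j) {n : ℕ} {t : ℝ≥0}
    (h1 : j n ≤ t) (h2 : t < j (n + 1)) : zigzagFun y₀ w₀ j t =
      (jumpPos y₀ w₀ j n + ((t : ℝ) - j n) * flipVelocity w₀ n, flipVelocity w₀ n) := by
  rw [zigzagFun, jumpCount_eq hj h1 h2]

open Classical in
/-- The Zig-Zag path started at `(y₀, w₀)` with jump times `j`, as a càdlàg path; a constant path
if `j` is not a sequence of jump times. -/
noncomputable def zigzagPath (y₀ : ℝ) (w₀ : ℤˣ) (j : ℕ → ℝ≥0) : Cadlag (ℝ × ℝ) :=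
  if hj : IsJumpSeq j then
    { toFun := zigzagFun y₀ w₀ j
      right_continuous := fun t => by
        obtain ⟨n, h1, h2⟩ := hj.exists_index t
        have hc : Continuous fun s : ℝ≥0 =>
            (jumpPos y₀ w₀ j n + ((s : ℝ) - j n) * flipVelocity w₀ n, flipVelocity w₀ n) := by
          fun_prop
        refine hc.continuousWithinAt.congr_of_eventuallyEq ?_ (zigzagFun_eq y₀ w₀ hj.strictMono h1 h2)
        filter_upwards [self_mem_nhdsWithin, nhdsWithin_le_nhds (Iio_mem_nhds h2)] with s hs hs'
        exact zigzagFun_eq y₀ w₀ hj.strictMono (h1.trans hs) hs'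
      left_limit := fun t => by
        rcases eq_or_ne t 0 with rfl | ht
        · refine ⟨0, ?_⟩
          have : Iio (0 : ℝ≥0) = ∅ := by ext; simp
          rw [this, nhdsWithin_empty]
          exact tendsto_bot
        obtain ⟨n, h1, h2⟩ := hj.exists_index_left ht
        have hc : Continuous fun s : ℝ≥0 =>
            (jumpPos y₀ w₀ j n + ((s : ℝ) - j n) * flipVelocity w₀ n, flipVelocity w₀ n) := by
          fun_prop
        refine ⟨_, (hc.continuousWithinAt (s := Iio t) (x := t)).congr' ?_⟩
        filter_upwards [self_mem_nhdsWithin, nhdsWithin_le_nhds (Ioi_mem_nhds h1)] with s hs hs'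
        exact (zigzagFun_eq y₀ w₀ hj.strictMono (le_of_lt hs') (lt_of_lt_of_le hs h2)).symm }
  else Cadlag.ofSeq one_pos fun _ => 0

theorem zigzagPath_apply (y₀ : ℝ) (w₀ : ℤˣ) {j : ℕ → ℝ≥0} (hj : IsJumpSeq j) {n : ℕ} {t : ℝ≥0}
    (h1 : j n ≤ t) (h2 : t < j (n + 1)) : zigzagPath y₀ w₀ j t =
      (jumpPos y₀ w₀ j n + ((t : ℝ) - j n) * flipVelocity w₀ n, flipVelocity w₀ n) := by
  rw [zigzagPath, dif_pos hj]
  exact zigzagFun_eq y₀ w₀ hj.strictMono h1 h2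

theorem abs_flipVelocity (w₀ : ℤˣ) (n : ℕ) : |flipVelocity w₀ n| = 1 := by
  rcases Int.units_eq_one_or ((-1) ^ n * w₀) with h | h <;> simp [flipVelocity, h]

/-- Paths whose jump times and positions at the jump times converge to those of a Zig-Zag path and
which are nearly linear in between converge to it. -/
theorem tendsto_zigzagPath {y₀ : ℝ} {w₀ : ℤˣ} {j : ℕ → ℝ≥0} (hj : IsJumpSeq j) {ι : Type*}
    {l : Filter ι} {Z : ι → Cadlag (ℝ × ℝ)} {a : ι → ℕ → ℝ≥0} {p : ι → ℕ → ℝ} {r : ι → ℝ}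
    (ha0 : ∀ᶠ i in l, a i 0 = 0) (ha : ∀ n, Tendsto (fun i => a i n) l (𝓝 (j n)))
    (hp : ∀ n, Tendsto (fun i => p i n) l (𝓝 (jumpPos y₀ w₀ j n))) (hr : Tendsto r l (𝓝 0))
    (hZ : ∀ᶠ i in l, ∀ (n : ℕ) (t : ℝ≥0), a i n ≤ t → t < a i (n + 1) →
      |(Z i t).1 - (p i n + ((t : ℝ) - a i n) * flipVelocity w₀ n)| ≤ r i ∧
        (Z i t).2 = flipVelocity w₀ n) :
    Tendsto Z l (𝓝 (zigzagPath y₀ w₀ j)) := by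
  refine Cadlag.tendsto_nhds_iff.2 fun T δ hδ => ?_
  obtain ⟨N, hN⟩ := hj.exists_lt T
  -- Four errors are added, each below `δ / 5`: the deviation `r` from linearity, the position at
  -- the jump, the displacement of `t`, and that of the jump time.
  have hδ5 : 0 < δ / 5 := by positivity
  obtain ⟨η, hη, H⟩ := Cadlag.exists_timeChange hj.1 hj.strictMono N hδ5
  have e1 : ∀ᶠ i in l, ∀ n ∈ Finset.range (N + 1), dist (a i n) (j n) < min η (δ / 5) := by
    rw [Finset.eventually_all]
    exact fun n _ => (ha n).eventually (Metric.ball_mem_nhds _ (lt_min hη hδ5))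
  have e2 : ∀ᶠ i in l, ∀ n ∈ Finset.range (N + 1), dist (p i n) (jumpPos y₀ w₀ j n) < δ / 5 := by
    rw [Finset.eventually_all]
    exact fun n _ => (hp n).eventually (Metric.ball_mem_nhds _ hδ5)
  filter_upwards [ha0, e1, e2, hr.eventually (Metric.ball_mem_nhds _ hδ5), hZ]
    with i h0 h1 h2 h3 h4
  obtain ⟨γ, hγ, hγ'⟩ := H (a i) h0 fun n hn =>
    (h1 n (Finset.mem_range_succ_iff.2 hn)).trans_le (min_le_left _ _)
  refine ⟨γ, fun t ht => ⟨(hγ' t).trans (by linarith), ?_⟩⟩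
  obtain ⟨n, hn1, hn2⟩ := hj.exists_index t
  have hnN : n < N := hj.strictMono.lt_iff_lt.1 (hn1.trans_lt (ht.trans_lt hN))
  have hn : n ∈ Finset.range (N + 1) := Finset.mem_range_succ_iff.2 hnN.le
  -- As `γ` matches the jump times, `t` and `γ t` lie in intervals of the same index, so the
  -- velocities agree exactly.
  obtain ⟨h5, h6⟩ := h4 n (γ t) (by rw [← hγ n hnN.le]; exact γ.monotone hn1)
    (by rw [← hγ (n + 1) hnN]; exact γ.strictMono hn2)
  simp only
  rw [zigzagPath_apply y₀ w₀ hj hn1 hn2, Prod.dist_eq, h6, dist_self,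
    max_eq_left dist_nonneg, Real.dist_eq]
  have h7 : |(a i n : ℝ) - j n| < δ / 5 := (h1 n hn).trans_le (min_le_right _ _)
  have h8 : |p i n - jumpPos y₀ w₀ j n| < δ / 5 := h2 n hn
  have h9 : |((γ t : ℝ≥0) : ℝ) - t| < δ / 5 := hγ' t
  have h10 : r i < δ / 5 := by
    have : |r i - 0| < δ / 5 := h3
    rw [sub_zero] at this
    exact (le_abs_self _).trans_lt this
  have h11 : |(((γ t : ℝ≥0) : ℝ) - t - (a i n - j n)) * flipVelocity w₀ n| < δ / 5 + δ / 5 := by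
    rw [abs_mul, abs_flipVelocity, mul_one]
    exact (abs_sub _ _).trans_lt (add_lt_add h9 h7)
  rw [abs_le] at h5
  rw [abs_lt] at h8 h11 ⊢
  constructor <;> nlinarith

theorem measurableSet_isJumpSeq : MeasurableSet {j | IsJumpSeq j} := by
  simp only [IsJumpSeq, ofPred_and, ofPred_forall, ofPred_exists]
  refine (measurableSet_eq_fun (by fun_prop) (by fun_prop)).inter (.inter ?_ ?_)
  · exact .iInter fun n => measurableSet_lt (by fun_prop) (by fun_prop)
  · exact .iInter fun M => .iUnion fun n => measurableSet_lt (by fun_prop) (by fun_prop)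

/-- On the measurable set of jump sequences, `tendsto_zigzagPath` with zero deviation gives
continuity; elsewhere the path is constant in `j`. -/
theorem measurable_zigzagPath (y₀ : ℝ) (w₀ : ℤˣ) : Measurable (zigzagPath y₀ w₀) := by
  classical
  have hc : ContinuousOn (zigzagPath y₀ w₀) {j | IsJumpSeq j} := by
    intro j hj
    refine tendsto_zigzagPath (a := id) (p := fun j' => jumpPos y₀ w₀ j') (r := fun _ => 0) hj
      ?_ ?_ ?_ tendsto_const_nhds ?_
    · filter_upwards [self_mem_nhdsWithin] with j' hj' using hj'.1
    · exact fun n => ((continuous_apply n).tendsto j).mono_left nhdsWithin_le_nhds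
    · exact fun n => ((continuous_jumpPos y₀ w₀ n).tendsto j).mono_left nhdsWithin_le_nhds
    · filter_upwards [self_mem_nhdsWithin] with j' hj' n t h1 h2
      rw [zigzagPath_apply y₀ w₀ hj' h1 h2]
      simp
  have h := hc.measurable_piecewise
    (continuousOn_const (c := Cadlag.ofSeq one_pos fun _ => (0 : ℝ × ℝ)) (s := {j | IsJumpSeq j}ᶜ))
    measurableSet_isJumpSeq
  convert h using 1
  funext j
  by_cases hj : IsJumpSeq j
  · simp [Set.piecewise, hj]
  · simp [Set.piecewise, hj, zigzagPath]

/-! ### The integrated jump rate -/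

theorem abs_units_cast (v : ℤˣ) : |((v : ℤ) : ℝ)| = 1 := by
  rcases Int.units_eq_one_or v with h | h <;> simp [h]

/-- The integrated jump rate of the Zig-Zag process along the flow started at `(y, w)`. -/
noncomputable def hazard (H : ℝ → ℝ) (y w t : ℝ) : ℝ :=
  ∫ s in (0 : ℝ)..t, max (w * deriv H (y + s * w)) 0

theorem noJumpProb_eq (H : ℝ → ℝ) (y w : ℝ) (t : ℝ≥0) :
    noJumpProb H y w t = Real.exp (-hazard H y w t) := rfl

theorem continuous_rate {H : ℝ → ℝ} (hH : Continuous (deriv H))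
    (y w : ℝ) : Continuous fun s => max (w * deriv H (y + s * w)) 0 := by
  fun_prop

theorem continuous_hazard {H : ℝ → ℝ} (hH : Continuous (deriv H))
    (w : ℝ) : Continuous fun p : ℝ × ℝ => hazard H p.1 w p.2 := by
  refine intervalIntegral.continuous_parametric_intervalIntegral_of_continuous
    (f := fun (p : ℝ × ℝ) s => max (w * deriv H (p.1 + s * w)) 0) ?_ continuous_snd
  simp only [Function.uncurry_def]
  fun_prop

theorem hazard_add {H : ℝ → ℝ} (hH : Continuous (deriv H))
    (y w s t : ℝ) :
    hazard H y w (s + t) = hazard H y w s + hazard H (y + s * w) w t := by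
  have h := continuous_rate hH y w
  have h1 : hazard H (y + s * w) w t = ∫ r in s..(s + t), max (w * deriv H (y + r * w)) 0 := by
    have h2 := intervalIntegral.integral_comp_add_left (a := 0) (b := t)
      (fun r => max (w * deriv H (y + r * w)) 0) s
    rw [add_zero] at h2
    rw [hazard, ← h2]
    congr 1
    funext r
    ring_nf
  rw [h1, hazard, hazard, intervalIntegral.integral_add_adjacent_intervals
    (h.intervalIntegrable _ _) (h.intervalIntegrable _ _)]

theorem hazard_nonneg {H : ℝ → ℝ}
    (y w : ℝ) {t : ℝ} (ht : 0 ≤ t) : 0 ≤ hazard H y w t :=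
  intervalIntegral.integral_nonneg ht fun _ _ => le_max_right _ _

theorem hazard_mono {H : ℝ → ℝ} (hH : Continuous (deriv H))
    (y w : ℝ) : Monotone (hazard H y w) := by
  intro s t hst
  have := hazard_add hH y w s (t - s)
  rw [add_sub_cancel] at this
  rw [this]
  exact le_add_of_nonneg_right (hazard_nonneg _ _ (sub_nonneg.2 hst))

theorem hazard_zero {H : ℝ → ℝ}
    (y w : ℝ) : hazard H y w 0 = 0 := intervalIntegral.integral_same

theorem hazard_le_mul {H : ℝ → ℝ} (hH : Continuous (deriv H))
    {y w C : ℝ} {t : ℝ} (ht : 0 ≤ t)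
    (h : ∀ s ∈ Icc 0 t, max (w * deriv H (y + s * w)) 0 ≤ C) : hazard H y w t ≤ C * t := by
  have := intervalIntegral.integral_mono_on ht ((continuous_rate hH y w).intervalIntegrable _ _)
    (intervalIntegrable_const (μ := volume) (c := C)) h
  rw [intervalIntegral.integral_const, sub_zero, smul_eq_mul, mul_comm] at this
  exact this

theorem integral_signed_rate {H : ℝ → ℝ} (hH : Continuous (deriv H)) (hd : Differentiable ℝ H)
    (y w t : ℝ) :
    ∫ s in (0 : ℝ)..t, w * deriv H (y + s * w) = H (y + t * w) - H y := by
  have h := intervalIntegral.integral_eq_sub_of_hasDerivAt (a := 0) (b := t)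
    (f := fun s => H (y + s * w)) (f' := fun s => w * deriv H (y + s * w)) (fun s _ => by
      have h1 : HasDerivAt (fun s : ℝ => y + s * w) w s := by
        simpa using ((hasDerivAt_id s).mul_const w).const_add y
      have := (hd (y + s * w)).hasDerivAt.comp s h1
      rwa [mul_comm] at this)
    ((by fun_prop : Continuous fun s => w * deriv H (y + s * w)).intervalIntegrable _ _)
  simpa using h

/-- The positive part dominates the signed rate, whose integral is the increment of `H`. Combined
with the growth of `H`, this makes every clock run out in finite time. -/
theorem sub_le_hazard {H : ℝ → ℝ} (hH : Continuous (deriv H)) (hd : Differentiable ℝ H)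
    (y w : ℝ) {t : ℝ} (ht : 0 ≤ t) : H (y + t * w) - H y ≤ hazard H y w t := by
  rw [← integral_signed_rate hH hd]
  refine intervalIntegral.integral_mono_on ht
    ((by fun_prop : Continuous fun s => w * deriv H (y + s * w)).intervalIntegrable _ _)
    ((continuous_rate hH y w).intervalIntegrable _ _) fun s _ => le_max_left _ _

theorem tendsto_hazard_atTop {H : ℝ → ℝ} (hH : Continuous (deriv H)) (hd : Differentiable ℝ H)
    (hHtop : Tendsto H (cocompact ℝ) atTop)
    (y : ℝ) (w : ℝ) (hw : |w| = 1) :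
    Tendsto (hazard H y w) atTop atTop := by
  have h1 : Tendsto (fun t : ℝ => y + t * w) atTop (cocompact ℝ) := by
    rw [← Metric.cobounded_eq_cocompact, ← tendsto_norm_atTop_iff_cobounded]
    have : Tendsto (fun t : ℝ => t - |y|) atTop atTop := tendsto_atTop_add_const_right _ _ tendsto_id
    refine tendsto_atTop_mono' _ ?_ this
    filter_upwards [eventually_ge_atTop 0] with t ht
    have h2 : |t * w| = t := by rw [abs_mul, hw, mul_one, abs_of_nonneg ht]
    have h3 := abs_sub_abs_le_abs_sub (t * w) (-y)
    rw [abs_neg, h2, sub_neg_eq_add, add_comm (t * w)] at h3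
    exact h3
  refine tendsto_atTop_mono' _ ?_ (tendsto_atTop_add_const_right _ (-H y) (hHtop.comp h1))
  filter_upwards [eventually_ge_atTop 0] with t ht
  exact sub_le_hazard hH hd y w ht

/-- The holding time of the Zig-Zag process at `(y, w)`, as a function of an
exponential variable. -/
noncomputable def holdTime (H : ℝ → ℝ) (y w e : ℝ) : ℝ≥0 :=
  sInf {t : ℝ≥0 | e ≤ hazard H y w t}

theorem le_hazard_holdTime {H : ℝ → ℝ} (hH : Continuous (deriv H)) (hd : Differentiable ℝ H)
    (hHtop : Tendsto H (cocompact ℝ) atTop)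
    (y w e : ℝ) (hw : |w| = 1) :
    e ≤ hazard H y w (holdTime H y w e) := by
  have hne : {t : ℝ≥0 | e ≤ hazard H y w t}.Nonempty := by
    obtain ⟨t, h1, h2⟩ := (((tendsto_hazard_atTop hH hd hHtop y w hw).eventually
      (eventually_ge_atTop e)).and (eventually_ge_atTop 0)).exists
    exact ⟨⟨t, h2⟩, h1⟩
  have hc : IsClosed {t : ℝ≥0 | e ≤ hazard H y w t} :=
    isClosed_le continuous_const ((continuous_hazard hH w).comp
      (continuous_const.prodMk NNReal.continuous_coe))
  exact hc.csInf_mem hne (OrderBot.bddBelow _)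

/-- The holding time is the generalized inverse of the integrated rate. Hence it exceeds `t` with
the probability `exp (-hazard)` that an exponential clock exceeds the rate integrated up to `t`. -/
theorem lt_holdTime_iff {H : ℝ → ℝ} (hH : Continuous (deriv H)) (hd : Differentiable ℝ H)
    (hHtop : Tendsto H (cocompact ℝ) atTop)
    (y w e : ℝ) (hw : |w| = 1) (t : ℝ≥0) :
    t < holdTime H y w e ↔ hazard H y w t < e := by
  rw [← not_le, ← not_le, not_iff_not]
  refine ⟨fun h => (le_hazard_holdTime hH hd hHtop y w e hw).trans (hazard_mono hH y w ?_),
    fun h => csInf_le (OrderBot.bddBelow _) h⟩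
  exact_mod_cast h

theorem hazard_holdTime {H : ℝ → ℝ} (hH : Continuous (deriv H)) (hd : Differentiable ℝ H)
    (hHtop : Tendsto H (cocompact ℝ) atTop)
    (y w e : ℝ) (hw : |w| = 1) (he : 0 ≤ e) :
    hazard H y w (holdTime H y w e) = e := by
  refine le_antisymm ?_ (le_hazard_holdTime hH hd hHtop y w e hw)
  rcases eq_or_ne (holdTime H y w e) 0 with h | h
  · rw [h, NNReal.coe_zero, hazard_zero]; exact he
  have hc : Continuous fun t : ℝ≥0 => hazard H y w t :=
    (continuous_hazard hH w).comp (continuous_const.prodMk NNReal.continuous_coe)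
  have hne : (𝓝[<] holdTime H y w e).NeBot :=
    nhdsLT_neBot_of_exists_lt ⟨0, pos_iff_ne_zero.2 h⟩
  refine le_of_tendsto (hc.continuousWithinAt (s := Iio (holdTime H y w e))) ?_
  filter_upwards [self_mem_nhdsWithin] with t ht
  exact ((lt_holdTime_iff hH hd hHtop y w e hw t).1 ht).le

theorem holdTime_pos {H : ℝ → ℝ} (hH : Continuous (deriv H)) (hd : Differentiable ℝ H)
    (hHtop : Tendsto H (cocompact ℝ) atTop)
    (y w e : ℝ) (hw : |w| = 1) (he : 0 < e) : 0 < holdTime H y w e := by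
  rw [lt_holdTime_iff hH hd hHtop y w e hw, NNReal.coe_zero, hazard_zero]
  exact he

theorem measurable_holdTime {H : ℝ → ℝ} (hH : Continuous (deriv H)) (hd : Differentiable ℝ H)
    (hHtop : Tendsto H (cocompact ℝ) atTop)
    (w : ℝ) (hw : |w| = 1) :
    Measurable fun p : ℝ × ℝ => holdTime H p.1 w p.2 := by
  refine measurable_of_Ioi fun t => ?_
  have : (fun p : ℝ × ℝ => holdTime H p.1 w p.2) ⁻¹' Ioi t =
      {p : ℝ × ℝ | hazard H p.1 w t < p.2} := by
    ext p
    exact lt_holdTime_iff hH hd hHtop p.1 w p.2 hw t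
  rw [this]
  refine (isOpen_lt ?_ continuous_snd).measurableSet
  exact (continuous_hazard hH w).comp (continuous_fst.prodMk continuous_const)

/-- A plateau of the integrated rate at level `e` after the holding time would contain a rational
time. Without one, the holding time is stable under perturbation of the rate, and only countably
many levels have to be excluded. -/
theorem lt_hazard_of_ne {H : ℝ → ℝ} (hH : Continuous (deriv H)) (hd : Differentiable ℝ H)
    (hHtop : Tendsto H (cocompact ℝ) atTop)
    (y w e : ℝ) (hw : |w| = 1)
    (hne : ∀ q : ℚ, hazard H y w q ≠ e) {t : ℝ} (ht : holdTime H y w e < t) :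
    e < hazard H y w t := by
  obtain ⟨q, h1, h2⟩ := exists_rat_btwn ht
  have h3 := (le_hazard_holdTime hH hd hHtop y w e hw).trans (hazard_mono hH y w h1.le)
  exact (lt_of_le_of_ne h3 (hne q).symm).trans_le (hazard_mono hH y w h2.le)

/-! ### The discrete integrated jump rate -/

/-- Minus the logarithm of the probability that the walk makes `m` moves in a row from `(x, v)`. -/
noncomputable def walkHazard (U : ℤ → ℝ) (x : ℤ) (v : ℤˣ) (m : ℕ) : ℝ :=
  ∑ k ∈ Finset.range m, max (U (x + (k + 1) * v) - U (x + k * v)) 0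

/-- The number of moves of the walk from `(x, v)` before the velocity flips, as a function of an
exponential variable. -/
noncomputable def moveCount (U : ℤ → ℝ) (x : ℤ) (v : ℤˣ) (e : ℝ) : ℕ :=
  sInf {m | e ≤ walkHazard U x v (m + 1)}

theorem walkHazard_succ (U : ℤ → ℝ) (x : ℤ) (v : ℤˣ) (m : ℕ) : walkHazard U x v (m + 1) =
    walkHazard U x v m + max (U (x + (m + 1) * v) - U (x + m * v)) 0 :=
  Finset.sum_range_succ _ _

theorem walkHazard_mono (U : ℤ → ℝ) (x : ℤ) (v : ℤˣ) : Monotone (walkHazard U x v) := by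
  refine monotone_nat_of_le_succ fun m => ?_
  rw [walkHazard_succ]
  exact le_add_of_nonneg_right (le_max_right _ _)

theorem sub_le_walkHazard (U : ℤ → ℝ) (x : ℤ) (v : ℤˣ) (m : ℕ) :
    U (x + m * v) - U x ≤ walkHazard U x v m := by
  have h := Finset.sum_range_sub (fun k : ℕ => U (x + k * v)) m
  simp only [Nat.cast_zero, zero_mul, add_zero] at h
  rw [← h, walkHazard]
  refine Finset.sum_le_sum fun k _ => ?_
  push_cast
  exact le_max_left _ _

theorem tendsto_walkHazard_atTop {H : ℝ → ℝ}
    (hHtop : Tendsto H (cocompact ℝ) atTop) {ε : ℝ} (hε : 0 < ε)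
    (x : ℤ) (v : ℤˣ) :
    Tendsto (walkHazard (fun k : ℤ => H (ε * k)) x v) atTop atTop := by
  have h1 : Tendsto (fun m : ℕ => ε * ((x + m * v : ℤ) : ℝ)) atTop (cocompact ℝ) := by
    rw [← Metric.cobounded_eq_cocompact, ← tendsto_norm_atTop_iff_cobounded]
    have : Tendsto (fun m : ℕ => ε * m - |ε * x|) atTop atTop :=
      tendsto_atTop_add_const_right _ _ (tendsto_natCast_atTop_atTop.const_mul_atTop hε)
    refine tendsto_atTop_mono (fun m => ?_) this
    have h2 : |ε * m * (v : ℤ)| = ε * m := by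
      rw [abs_mul, abs_units_cast, mul_one, abs_of_nonneg (by positivity)]
    have h3 := abs_sub_abs_le_abs_sub (ε * m * (v : ℤ)) (-(ε * x))
    rw [abs_neg, h2] at h3
    refine h3.trans (le_of_eq ?_)
    rw [Real.norm_eq_abs]
    congr 1
    push_cast
    ring
  refine tendsto_atTop_mono (fun m => ?_)
    (tendsto_atTop_add_const_right _ (-H (ε * x)) (hHtop.comp h1))
  exact sub_le_walkHazard (fun k : ℤ => H (ε * k)) x v m

theorem le_walkHazard_moveCount {H : ℝ → ℝ}
    (hHtop : Tendsto H (cocompact ℝ) atTop) {ε : ℝ} (hε : 0 < ε)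
    (x : ℤ) (v : ℤˣ) (e : ℝ) :
    e ≤ walkHazard (fun k : ℤ => H (ε * k)) x v
      (moveCount (fun k : ℤ => H (ε * k)) x v e + 1) := by
  have : {m | e ≤ walkHazard (fun k : ℤ => H (ε * k)) x v (m + 1)}.Nonempty :=
    (((tendsto_add_atTop_iff_nat 1).2 (tendsto_walkHazard_atTop hHtop hε x v)).eventually
      (eventually_ge_atTop e)).exists
  exact Nat.sInf_mem this

/-- `moveCount` is the first `m` for which move `m + 1` would exhaust the clock, so the sum over the
moves made is still below `e`; with no move made, this is positivity of the clock. -/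
theorem walkHazard_lt_of_le_moveCount {U : ℤ → ℝ} {x : ℤ} {v : ℤˣ} {e : ℝ} (he : 0 < e) {m : ℕ}
    (hm : m ≤ moveCount U x v e) : walkHazard U x v m < e := by
  rcases m with - | m
  · simpa [walkHazard] using he
  · exact not_le.1 (Nat.notMem_of_lt_sInf (Nat.lt_of_succ_le hm))

/-- Both quantities are within `ω * ε` of `ε (v H'(u))₊`, because taking the positive part is
`1`-Lipschitz. -/
theorem abs_max_sub_hazard_le {H : ℝ → ℝ} (hH : Continuous (deriv H)) (hd : Differentiable ℝ H)
    {u v ε ω : ℝ} (hv : |v| = 1) (hε : 0 ≤ ε)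
    (h : ∀ s ∈ Icc 0 ε, |deriv H (u + s * v) - deriv H u| ≤ ω) :
    |max (H (u + ε * v) - H u) 0 - hazard H u v ε| ≤ ε * (2 * ω) := by
  have h1 : |(H (u + ε * v) - H u) - ε * (v * deriv H u)| ≤ ω * ε := by
    have e1 : (H (u + ε * v) - H u) - ε * (v * deriv H u) =
        ∫ s in (0 : ℝ)..ε, (v * deriv H (u + s * v) - v * deriv H u) := by
      rw [intervalIntegral.integral_sub
        ((by fun_prop : Continuous fun s => v * deriv H (u + s * v)).intervalIntegrable _ _)
        intervalIntegrable_const, integral_signed_rate hH hd, intervalIntegral.integral_const]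
      simp
    rw [e1]
    have := intervalIntegral.norm_integral_le_of_norm_le_const (a := 0) (b := ε) (C := ω)
      (f := fun s => v * deriv H (u + s * v) - v * deriv H u) fun s hs => by
        rw [uIoc_of_le hε] at hs
        rw [← mul_sub, norm_mul, Real.norm_eq_abs, Real.norm_eq_abs, hv, one_mul]
        exact h s ⟨hs.1.le, hs.2⟩
    rwa [sub_zero, abs_of_nonneg hε] at this
  have h2 : |hazard H u v ε - ε * max (v * deriv H u) 0| ≤ ω * ε := by
    have e1 : hazard H u v ε - ε * max (v * deriv H u) 0 =
        ∫ s in (0 : ℝ)..ε, (max (v * deriv H (u + s * v)) 0 - max (v * deriv H u) 0) := by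
      rw [intervalIntegral.integral_sub ((continuous_rate hH u v).intervalIntegrable _ _)
        intervalIntegrable_const, intervalIntegral.integral_const]
      simp [hazard]
    rw [e1]
    have := intervalIntegral.norm_integral_le_of_norm_le_const (a := 0) (b := ε) (C := ω)
      (f := fun s => max (v * deriv H (u + s * v)) 0 - max (v * deriv H u) 0) fun s hs => by
        rw [uIoc_of_le hε] at hs
        refine (abs_max_sub_max_le_abs _ _ _).trans ?_
        rw [← mul_sub, abs_mul, hv, one_mul]
        exact h s ⟨hs.1.le, hs.2⟩
    rwa [sub_zero, abs_of_nonneg hε] at this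
  have h3 := (abs_max_sub_max_le_abs (H (u + ε * v) - H u) (ε * (v * deriv H u)) 0).trans h1
  have h4 : max (ε * (v * deriv H u)) 0 = ε * max (v * deriv H u) 0 := by
    rw [mul_max_of_nonneg _ _ hε, mul_zero]
  rw [h4] at h3
  rw [abs_le] at *
  constructor <;> linarith

/-- The one-step errors add up over `m` steps. The radius `R` contains the whole trajectory, and `ω`
bounds the oscillation of `H'` there at scale `ε`. -/
theorem abs_walkHazard_sub_le {H : ℝ → ℝ} (hH : Continuous (deriv H)) (hd : Differentiable ℝ H)
    {ε ω R : ℝ} (hε : 0 ≤ ε) (x : ℤ) (v : ℤˣ) (m : ℕ)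
    (hR : |ε * x| + ε * m ≤ R)
    (h : ∀ a b, |a| ≤ R → |b| ≤ R → |a - b| ≤ ε → |deriv H a - deriv H b| ≤ ω) :
    |walkHazard (fun k : ℤ => H (ε * k)) x v m - hazard H (ε * x) (v : ℤ) (ε * m)| ≤
      ε * m * (2 * ω) := by
  have hv := abs_units_cast v
  induction m with
  | zero => simp [walkHazard, hazard_zero]
  | succ m ih =>
    push_cast at hR
    have ih' := ih (by linarith)
    have hu : ∀ s ∈ Icc 0 ε, |ε * x + ε * m * (v : ℤ) + s * (v : ℤ)| ≤ R := by
      intro s hs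
      have e1 : |ε * m * (v : ℤ) + s * (v : ℤ)| ≤ ε * m + ε := by
        rw [← add_mul, abs_mul, hv, mul_one, abs_of_nonneg (add_nonneg (by positivity) hs.1)]
        linarith [hs.2]
      rw [add_assoc]
      refine (abs_add_le _ _).trans ?_
      linarith
    have h1 := abs_max_sub_hazard_le hH hd (u := ε * x + ε * m * (v : ℤ)) hv hε (ω := ω)
      fun s hs => by
        refine h _ _ (hu s hs) (by simpa using hu 0 ⟨le_rfl, hε⟩) ?_
        rw [add_sub_cancel_left, abs_mul, hv, mul_one, abs_of_nonneg hs.1]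
        exact hs.2
    have h2 : walkHazard (fun k : ℤ => H (ε * k)) x v (m + 1) =
        walkHazard (fun k : ℤ => H (ε * k)) x v m +
          max (H (ε * x + ε * m * (v : ℤ) + ε * (v : ℤ)) - H (ε * x + ε * m * (v : ℤ))) 0 := by
      rw [walkHazard_succ]
      congr 4 <;> (push_cast; ring)
    have h3 : ε * ((m + 1 : ℕ) : ℝ) = ε * m + ε := by push_cast; ring
    rw [h2, h3, hazard_add hH]
    rw [abs_le] at *
    constructor <;> nlinarith

theorem tendsto_walkHazard {H : ℝ → ℝ} (hH : Continuous (deriv H)) (hd : Differentiable ℝ H)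
    {ι : Type*} {l : Filter ι} {ε : ι → ℝ} (hε0 : ∀ i, 0 < ε i)
    (hε : Tendsto ε l (𝓝 0)) {x : ι → ℤ} {y : ℝ} (hx : Tendsto (fun i => ε i * x i) l (𝓝 y))
    (v : ℤˣ) {m : ι → ℕ} {t : ℝ} (hm : Tendsto (fun i => ε i * m i) l (𝓝 t)) :
    Tendsto (fun i => walkHazard (fun k : ℤ => H (ε i * k)) (x i) v (m i)) l
      (𝓝 (hazard H y (v : ℤ) t)) := by
  have h1 : Tendsto (fun i => hazard H (ε i * x i) (v : ℤ) (ε i * m i)) l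
      (𝓝 (hazard H y (v : ℤ) t)) :=
    (((continuous_hazard hH ((v : ℤ) : ℝ)).tendsto (y, t)).comp (hx.prodMk_nhds hm) :)
  suffices h : Tendsto (fun i => walkHazard (fun k : ℤ => H (ε i * k)) (x i) v (m i) -
      hazard H (ε i * x i) (v : ℤ) (ε i * m i)) l (𝓝 0) by simpa using h.add h1
  -- Nonnegativity of `t` comes from that of `ε i * m i`, except along the trivial filter, where
  -- every limit holds.
  have ht : 0 ≤ t ∨ l = ⊥ := by
    rcases l.eq_or_neBot with h | h
    · exact .inr h
    · exact .inl (ge_of_tendsto hm (.of_forall fun i => by have := hε0 i; positivity))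
  rcases ht with ht | rfl
  swap
  · exact tendsto_bot
  rw [Metric.tendsto_nhds]
  intro δ hδ
  obtain ⟨ω, hω, hωδ⟩ : ∃ ω > 0, (t + 1) * (2 * ω) < δ := by
    refine ⟨δ / (4 * (t + 1)), by positivity, ?_⟩
    have : (t + 1) * (2 * (δ / (4 * (t + 1)))) = δ / 2 := by field_simp; norm_num
    rw [this]
    exact half_lt_self hδ
  -- Eventually `|ε x| ≤ |y| + 1` and `ε m ≤ t + 1`, whence the radius.
  have hK : UniformContinuousOn (deriv H) (Icc (-(|y| + t + 2)) (|y| + t + 2)) :=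
    isCompact_Icc.uniformContinuousOn_of_continuous hH.continuousOn
  obtain ⟨r, hr, hr'⟩ := Metric.uniformContinuousOn_iff.1 hK _ hω
  filter_upwards [hε.eventually (gt_mem_nhds hr), hm.eventually (gt_mem_nhds (lt_add_one t)),
    hx.abs.eventually (gt_mem_nhds (lt_add_one |y|))] with i h2 h3 h4
  have h5 := abs_walkHazard_sub_le hH hd (hε0 i).le (x i) v (m i) (R := |y| + t + 2)
    (ω := ω) (by linarith) fun a b ha hb hab =>
      (hr' a (abs_le.1 ha) b (abs_le.1 hb) (hab.trans_lt h2)).le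
  rw [Real.dist_eq, sub_zero]
  have h6 : ε i * m i ≤ t + 1 := h3.le
  have h7 : 0 ≤ 2 * ω := mul_nonneg zero_le_two hω.le
  exact (h5.trans (mul_le_mul_of_nonneg_right h6 h7)).trans_lt hωδ

theorem tendsto_moveCount {H : ℝ → ℝ} (hH : Continuous (deriv H)) (hd : Differentiable ℝ H)
    (hHtop : Tendsto H (cocompact ℝ) atTop) {ι : Type*} {l : Filter ι}
    {ε : ι → ℝ} (hε0 : ∀ i, 0 < ε i) (hε : Tendsto ε l (𝓝 0)) {x : ι → ℤ} {y : ℝ}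
    (hx : Tendsto (fun i => ε i * x i) l (𝓝 y)) (v : ℤˣ) {e : ℝ} (he : 0 < e)
    (hne : ∀ q : ℚ, hazard H y (v : ℤ) q ≠ e) :
    Tendsto (fun i => ε i * moveCount (fun k : ℤ => H (ε i * k)) (x i) v e) l
      (𝓝 (holdTime H y (v : ℤ) e)) := by
  have hv := abs_units_cast v
  have hfloor : ∀ t : ℝ, 0 ≤ t → Tendsto (fun i => ε i * (⌊t / ε i⌋₊ : ℝ)) l (𝓝 t) := by
    intro t ht
    have h0 : Tendsto (fun i => t - ε i) l (𝓝 t) := by simpa using hε.const_sub t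
    refine tendsto_of_tendsto_of_tendsto_of_le_of_le h0 tendsto_const_nhds (fun i => ?_)
      (fun i => ?_)
    · have := Nat.lt_floor_add_one (t / ε i)
      rw [div_lt_iff₀ (hε0 i)] at this
      simp only
      nlinarith
    · have := Nat.floor_le (div_nonneg ht (hε0 i).le)
      rw [le_div_iff₀ (hε0 i)] at this
      simp only
      linarith
  rw [tendsto_order]
  constructor
  · intro t ht
    rcases lt_or_ge t 0 with ht0 | ht0
    · exact .of_forall fun i => ht0.trans_le (mul_nonneg (hε0 i).le (Nat.cast_nonneg _))
    have h1 : Tendsto (fun i => ε i * ((⌊t / ε i⌋₊ + 1 : ℕ) : ℝ)) l (𝓝 t) := by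
      have := (hfloor t ht0).add hε
      simpa [mul_add] using this
    have h2 : hazard H y (v : ℤ) t < e :=
      (lt_holdTime_iff hH hd hHtop y _ e hv ⟨t, ht0⟩).1 ht
    filter_upwards [(tendsto_walkHazard hH hd hε0 hε hx v h1).eventually (gt_mem_nhds h2)]
      with i h3
    -- Before the limit holding time, `⌊t / ε⌋ + 1` moves do not yet exhaust the clock.
    have h4 : ⌊t / ε i⌋₊ + 1 ≤ moveCount (fun k : ℤ => H (ε i * k)) (x i) v e := by
      by_contra! h
      have h5 := le_walkHazard_moveCount hHtop (hε0 i) (x i) v e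
      exact absurd (h5.trans (walkHazard_mono _ _ _ (Nat.succ_le_of_lt h))) (not_le.2 h3)
    have h4' : (⌊t / ε i⌋₊ : ℝ) + 1 ≤ moveCount (fun k : ℤ => H (ε i * k)) (x i) v e := by
      exact_mod_cast h4
    have h5 := (Nat.lt_floor_add_one (t / ε i)).trans_le h4'
    rw [div_lt_iff₀ (hε0 i)] at h5
    linarith
  · intro t ht
    obtain ⟨t', ht1, ht2⟩ := exists_between ht
    have ht0' : 0 ≤ t' := le_trans (holdTime H y (v : ℤ) e).2 ht1.le
    -- This is where the absence of a plateau is needed: just past the holding time the limit rate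
    -- already exceeds `e` strictly.
    have h2 := lt_hazard_of_ne hH hd hHtop y _ e hv hne ht1
    filter_upwards [(tendsto_walkHazard hH hd hε0 hε hx v (hfloor t' ht0')).eventually
      (lt_mem_nhds h2)] with i h3
    have h4 : moveCount (fun k : ℤ => H (ε i * k)) (x i) v e < ⌊t' / ε i⌋₊ := by
      by_contra! h
      exact absurd (walkHazard_lt_of_le_moveCount he h) (not_lt.2 h3.le)
    have h5 : (moveCount (fun k : ℤ => H (ε i * k)) (x i) v e : ℝ) < ⌊t' / ε i⌋₊ := by
      exact_mod_cast h4
    have h6 := Nat.floor_le (div_nonneg ht0' (hε0 i).le)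
    rw [le_div_iff₀ (hε0 i)] at h6
    nlinarith [hε0 i]

/-! ### Independent exponential clocks -/

instance instMeasurableSingletonClassIntUnits : MeasurableSingletonClass ℤˣ where
  measurableSet_singleton u :=
    ⟨{(u : ℤ)}, measurableSet_singleton _, by ext v; simp [Units.ext_iff]⟩

instance instIsProbabilityMeasureExpMeasureOne : IsProbabilityMeasure (expMeasure 1) :=
  isProbabilityMeasure_expMeasure one_pos

instance instNullSingletonClassExpMeasureOne : NullSingletonClass (expMeasure 1) := by
  unfold expMeasure gammaMeasure
  infer_instance

theorem expMeasure_Ioi {a : ℝ} (ha : 0 ≤ a) :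
    expMeasure 1 (Ioi a) = ENNReal.ofReal (Real.exp (-a)) := by
  have h1 : expMeasure 1 (Iic a) = ENNReal.ofReal (1 - Real.exp (-a)) := by
    rw [← ofReal_cdf, cdf_expMeasure_eq one_pos, if_pos ha, one_mul]
  rw [← compl_Iic, prob_compl_eq_one_sub measurableSet_Iic, h1, ← ENNReal.ofReal_one,
    ← ENNReal.ofReal_sub _ (by simpa using ha)]
  congr 1
  ring

theorem expMeasure_real_Ioi {a : ℝ} (ha : 0 ≤ a) :
    (expMeasure 1).real (Ioi a) = Real.exp (-a) := by
  rw [measureReal_def, expMeasure_Ioi ha, ENNReal.toReal_ofReal (Real.exp_pos _).le]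

/-- The law of a sequence of independent standard exponential variables. -/
noncomputable def clockMeasure : Measure (ℕ → ℝ) := Measure.infinitePi fun _ => expMeasure 1

instance instIsProbabilityMeasureClockMeasure : IsProbabilityMeasure clockMeasure := by
  unfold clockMeasure
  infer_instance

theorem clockMeasure_real_box (N : ℕ) {B : ℕ → Set ℝ} (hB : ∀ i, MeasurableSet (B i)) :
    clockMeasure.real {e | ∀ i ≤ N, e i ∈ B i} =
      ∏ i ∈ Finset.range (N + 1), (expMeasure 1).real (B i) := by
  have h1 : {e : ℕ → ℝ | ∀ i ≤ N, e i ∈ B i} = (Finset.range (N + 1) : Set ℕ).pi B := by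
    ext e; simp [Set.mem_pi]
  rw [h1, measureReal_def, clockMeasure, Measure.infinitePi_pi _ fun i _ => hB i,
    ENNReal.toReal_prod]
  rfl

theorem map_clockMeasure_eval (n : ℕ) : clockMeasure.map (fun e => e n) = expMeasure 1 :=
  Measure.infinitePi_map_eval (fun _ => expMeasure 1) n

/-- A function of the first `n` clocks is independent of the clock of index `n`. -/
theorem map_clockMeasure_prod {E : Type*} [MeasurableSpace E] {n : ℕ} {g : (ℕ → ℝ) → E}
    (hg : Measurable g) (hgn : ∀ e e' : ℕ → ℝ, (∀ i < n, e i = e' i) → g e = g e') :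
    clockMeasure.map (fun e => (g e, e n)) = (clockMeasure.map g).prod (expMeasure 1) := by
  have h1 : iIndepFun (fun (i : ℕ) (e : ℕ → ℝ) => e i) clockMeasure :=
    iIndepFun_infinitePi (P := fun _ => expMeasure 1) (X := fun _ x => x) fun _ => measurable_id
  have h2 := h1.indepFun_finset (Finset.range n) {n} (by simp) fun i => measurable_pi_apply i
  let φ : ((i : Finset.range n) → ℝ) → E := fun u =>
    g fun i => if h : i ∈ Finset.range n then u ⟨i, h⟩ else 0
  have hφ : Measurable φ := by
    refine hg.comp (measurable_pi_lambda _ fun i => ?_)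
    by_cases h : i ∈ Finset.range n
    · simp only [h, dif_pos]; fun_prop
    · simp only [h, dif_neg, not_false_eq_true]; fun_prop
  let ψ : ((i : ({n} : Finset ℕ)) → ℝ) → ℝ := fun u => u ⟨n, by simp⟩
  have hψ : Measurable ψ := measurable_pi_apply _
  have h3 := h2.comp hφ hψ
  have h4 : IndepFun g (fun e => e n) clockMeasure := by
    convert h3 using 1
    · funext e
      refine hgn _ _ fun i hi => ?_
      simp [hi]
    · rfl
  rw [← map_clockMeasure_eval n]
  exact h4.map_prod_eq_prod_map_map hg.aemeasurable (measurable_pi_apply n).aemeasurable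

/-- Laws of sequences are determined by those of their initial segments. -/
theorem map_eq_of_forall_fin {X Ω Ω' : Type*} [MeasurableSpace X] [MeasurableSpace Ω]
    [MeasurableSpace Ω'] {P : Measure Ω} {P' : Measure Ω'} [IsProbabilityMeasure P]
    {J : ℕ → Ω → X} {J' : ℕ → Ω' → X} (hJ : ∀ n, Measurable (J n)) (hJ' : ∀ n, Measurable (J' n))
    (h : ∀ n, P.map (fun ω (i : Fin (n + 1)) => J i ω) = P'.map (fun ω (i : Fin (n + 1)) => J' i ω)) :
    P.map (fun ω n => J n ω) = P'.map (fun ω n => J' n ω) := by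
  have hm : Measurable fun ω n => J n ω := measurable_pi_lambda _ hJ
  have hm' : Measurable fun ω n => J' n ω := measurable_pi_lambda _ hJ'
  have key : ∀ I : Finset ℕ, (P.map (fun ω n => J n ω)).map I.restrict =
      (P'.map (fun ω n => J' n ω)).map I.restrict := by
    intro I
    have hI : ∀ i ∈ I, i < I.sup id + 1 := fun i hi =>
      Nat.lt_succ_of_le (Finset.le_sup (f := id) hi)
    let g : (Fin (I.sup id + 1) → X) → ((i : I) → X) := fun u i => u ⟨i, hI i i.2⟩
    have hg : Measurable g := measurable_pi_lambda _ fun i => measurable_pi_apply _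
    have h1 := congrArg (Measure.map g) (h (I.sup id))
    rw [Measure.map_map hg (measurable_pi_lambda _ fun i => hJ _),
      Measure.map_map hg (measurable_pi_lambda _ fun i => hJ' _)] at h1
    rw [Measure.map_map (by fun_prop) hm, Measure.map_map (by fun_prop) hm']
    exact h1
  have := Measure.isProbabilityMeasure_map (μ := P) hm.aemeasurable
  have h0 : ∀ I : Finset ℕ,
      IsFiniteMeasure ((P.map (fun ω n => J n ω)).map I.restrict) := fun I => inferInstance
  exact IsProjectiveLimit.unique (P := fun I => (P.map (fun ω n => J n ω)).map I.restrict)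
    (fun I => rfl) (fun I => (key I).symm)

/-! ### The walk driven by exponential clocks -/

/-- One step of the walk driven by the clocks `e`, for a walk at `(x, v)` which has flipped `n`
times and accumulated the integrated jump rate `a` since then. -/
noncomputable def walkStep (U : ℤ → ℝ) (e : ℕ → ℝ) (s : ((ℤ × ℤˣ) × ℕ) × ℝ) :
    ((ℤ × ℤˣ) × ℕ) × ℝ :=
  if s.2 + max (U (s.1.1.1 + s.1.1.2) - U s.1.1.1) 0 < e s.1.2 then
    (((s.1.1.1 + s.1.1.2, s.1.1.2), s.1.2), s.2 + max (U (s.1.1.1 + s.1.1.2) - U s.1.1.1) 0)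
  else (((s.1.1.1, -s.1.1.2), s.1.2 + 1), 0)

/-- The states of the walk driven by the clocks `e`. -/
noncomputable def walkState (U : ℤ → ℝ) (x₀ : ℤ) (v₀ : ℤˣ) (e : ℕ → ℝ) :
    ℕ → ((ℤ × ℤˣ) × ℕ) × ℝ
  | 0 => (((x₀, v₀), 0), 0)
  | k + 1 => walkStep U e (walkState U x₀ v₀ e k)

theorem measurable_walkState (U : ℤ → ℝ) (x₀ : ℤ) (v₀ : ℤˣ) (k : ℕ) :
    Measurable fun e => walkState U x₀ v₀ e k := by
  -- The discrete part of the state is countable, so it may be frozen.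
  have h : Measurable fun p : ((ℕ → ℝ) × ℝ) × ((ℤ × ℤˣ) × ℕ) => walkStep U p.1.1 (p.2, p.1.2) := by
    refine measurable_from_prod_countable_left fun s => ?_
    simp only [walkStep]
    refine Measurable.ite (measurableSet_lt (by fun_prop) (by fun_prop)) ?_ measurable_const
    fun_prop
  induction k with
  | zero => exact measurable_const
  | succ k ih => exact h.comp ((measurable_id.prodMk ih.snd).prodMk ih.fst)

/-- In this form, a move is accepted with the probability that a clock survives the increment. -/
theorem walkAccept_eq (U : ℤ → ℝ) (x : ℤ) (v : ℤˣ) :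
    walkAccept U x v = Real.exp (-max (U (x + v) - U x) 0) := by
  rw [walkAccept, ← Real.exp_sub, ← Real.exp_zero, ← Real.exp_monotone.map_min]
  congr 1
  rw [← min_neg_neg, neg_zero]
  congr 1
  ring

/-- Events which constrain the clocks up to index `N` separately, the last of them being larger
than `A` on an event of the probability that it is. -/
def IsBoxEvent (F : Set (ℕ → ℝ)) (N : ℕ) (A : ℝ) : Prop :=
  0 ≤ A ∧ ∃ B : ℕ → Set ℝ, (∀ i, MeasurableSet (B i)) ∧ F = {e | ∀ i ≤ N, e i ∈ B i} ∧
    Ioi A ⊆ B N ∧ (expMeasure 1).real (B N) = Real.exp (-A)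

theorem isBoxEvent_univ : IsBoxEvent univ 0 0 :=
  ⟨le_rfl, fun _ => univ, fun _ => .univ, by simp, subset_univ _, by simp⟩

theorem IsBoxEvent.measurableSet {F : Set (ℕ → ℝ)} {N : ℕ} {A : ℝ} (h : IsBoxEvent F N A) :
    MeasurableSet F := by
  obtain ⟨-, B, hB, rfl, -⟩ := h
  simp only [ofPred_forall]
  exact .iInter fun i => .iInter fun _ => measurable_pi_apply i (hB i)

/-- Memorylessness: a clock known to exceed `A` exceeds `A + r` with conditional probability `exp
(-r)`, and the other clocks are unaffected. -/
theorem IsBoxEvent.accept {F : Set (ℕ → ℝ)} {N : ℕ} {A r : ℝ} (h : IsBoxEvent F N A)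
    (hr : 0 ≤ r) : IsBoxEvent (F ∩ {e | A + r < e N}) N (A + r) ∧
      clockMeasure.real (F ∩ {e | A + r < e N}) = clockMeasure.real F * Real.exp (-r) := by
  obtain ⟨hA, B, hB, rfl, hBA, hBN⟩ := h
  have hB' : ∀ i, MeasurableSet (Function.update B N (Ioi (A + r)) i) := fun i => by
    rcases eq_or_ne i N with rfl | hi
    · simp
    · simpa [hi] using hB i
  have hF : {e : ℕ → ℝ | ∀ i ≤ N, e i ∈ B i} ∩ {e | A + r < e N} =
      {e | ∀ i ≤ N, e i ∈ Function.update B N (Ioi (A + r)) i} := by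
    ext e
    constructor
    · rintro ⟨h1, h2⟩ i hi
      rcases eq_or_ne i N with rfl | hi'
      · simpa using h2
      · simpa [hi'] using h1 i hi
    · intro h1
      have h2 : A + r < e N := by simpa using h1 N le_rfl
      refine ⟨fun i hi => ?_, h2⟩
      rcases eq_or_ne i N with rfl | hi'
      · exact hBA (lt_of_le_of_lt (by linarith) h2)
      · simpa [hi'] using h1 i hi
  refine ⟨⟨by positivity, _, hB', hF, by simp, ?_⟩, ?_⟩
  · simp [expMeasure_real_Ioi (add_nonneg hA hr)]
  · rw [hF, clockMeasure_real_box N hB', clockMeasure_real_box N hB, Finset.prod_range_succ,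
      Finset.prod_range_succ, hBN, mul_assoc, ← Real.exp_add, Function.update_self,
      expMeasure_real_Ioi (add_nonneg hA hr)]
    congr 1
    · refine Finset.prod_congr rfl fun i hi => ?_
      rw [Function.update_of_ne (Finset.mem_range.1 hi).ne]
    · congr 1; ring

/-- The probability is that of the complementary case. Clock `N` is now used up, and the fresh clock
`N + 1` carries no constraint, hence level `0`. -/
theorem IsBoxEvent.reject {F : Set (ℕ → ℝ)} {N : ℕ} {A r : ℝ} (h : IsBoxEvent F N A)
    (hr : 0 ≤ r) : IsBoxEvent (F ∩ {e | ¬ A + r < e N}) (N + 1) 0 ∧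
      clockMeasure.real (F ∩ {e | ¬ A + r < e N}) =
        clockMeasure.real F * (1 - Real.exp (-r)) := by
  constructor
  · obtain ⟨hA, B, hB, rfl, hBA, hBN⟩ := h
    refine ⟨le_rfl, fun i => if i < N then B i else if i = N then B i ∩ Iic (A + r) else univ,
      fun i => ?_, ?_, by simp, by simp⟩
    · dsimp only
      split_ifs
      · exact hB i
      · exact (hB i).inter measurableSet_Iic
      · exact .univ
    · ext e
      constructor
      · rintro ⟨h1, h2⟩ i hi
        dsimp only
        split_ifs with h3 h4
        · exact h1 i h3.le
        · exact ⟨h1 i h4.le, h4 ▸ not_lt.1 h2⟩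
        · trivial
      · intro h1
        have h2 := h1 N (by omega)
        simp only [lt_irrefl, if_false, if_true] at h2
        refine ⟨fun i hi => ?_, not_lt.2 h2.2⟩
        rcases hi.lt_or_eq with h3 | rfl
        · simpa [h3] using h1 i (by omega)
        · exact h2.1
  · have h1 := (h.accept hr).2
    have h2 := measureReal_inter_add_sdiff (μ := clockMeasure) (s := F)
      (measurableSet_lt measurable_const (measurable_pi_apply N) :
        MeasurableSet {e : ℕ → ℝ | A + r < e N})
    have h3 : F \ {e : ℕ → ℝ | A + r < e N} = F ∩ {e | ¬ A + r < e N} := rfl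
    rw [h3] at h2
    linarith

/-- The first part is the invariant of the induction: a prescribed trajectory fixes the number of
flips and the accumulated rate, so it amounts to separate constraints on the clocks. The second part
is the Markov property, read off from `IsBoxEvent.accept` and `IsBoxEvent.reject`. -/
theorem walkState_cylinder (U : ℤ → ℝ) (x₀ : ℤ) (v₀ : ℤˣ) (s : ℕ → ℤ × ℤˣ) (k : ℕ) :
    ({e | ∀ i ≤ k, (walkState U x₀ v₀ e i).1.1 = s i} = ∅ ∨
      ∃ N A, IsBoxEvent {e | ∀ i ≤ k, (walkState U x₀ v₀ e i).1.1 = s i} N A ∧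
        ∀ e, (∀ i ≤ k, (walkState U x₀ v₀ e i).1.1 = s i) →
          walkState U x₀ v₀ e k = ((s k, N), A)) ∧
    ∀ m, k = m + 1 →
      clockMeasure.real {e | ∀ i ≤ m + 1, (walkState U x₀ v₀ e i).1.1 = s i} =
        clockMeasure.real {e | ∀ i ≤ m, (walkState U x₀ v₀ e i).1.1 = s i} *
          walkTransition U (s m) (s (m + 1)) := by
  induction k with
  | zero =>
    refine ⟨?_, fun m hm => by omega⟩
    by_cases h : (x₀, v₀) = s 0
    · refine .inr ⟨0, 0, ?_, fun e _ => by simp [walkState, h]⟩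
      convert isBoxEvent_univ
      simp [walkState, h]
    · left
      simp [walkState, h]
  | succ k ih =>
    obtain ⟨ih, -⟩ := ih
    suffices H : _ ∧ clockMeasure.real {e | ∀ i ≤ k + 1, (walkState U x₀ v₀ e i).1.1 = s i} =
        clockMeasure.real {e | ∀ i ≤ k, (walkState U x₀ v₀ e i).1.1 = s i} *
          walkTransition U (s k) (s (k + 1)) from
      ⟨H.1, fun m hm => by obtain rfl : k = m := by omega
                           exact H.2⟩
    set F := {e | ∀ i ≤ k, (walkState U x₀ v₀ e i).1.1 = s i} with hF
    have hF' : {e | ∀ i ≤ k + 1, (walkState U x₀ v₀ e i).1.1 = s i} =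
        F ∩ {e | (walkState U x₀ v₀ e (k + 1)).1.1 = s (k + 1)} := by
      ext e
      simp only [hF, mem_ofPred_eq, mem_inter_iff]
      refine ⟨fun h => ⟨fun i hi => h i (by omega), h _ le_rfl⟩, fun h i hi => ?_⟩
      rcases hi.lt_or_eq with h1 | rfl
      · exact h.1 i (by omega)
      · exact h.2
    have hmem : ∀ e, (∀ i ≤ k + 1, (walkState U x₀ v₀ e i).1.1 = s i) ↔
        e ∈ F ∩ {e | (walkState U x₀ v₀ e (k + 1)).1.1 = s (k + 1)} := fun e => by
      rw [← hF']; rfl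
    simp only [hmem]
    rcases ih with h0 | ⟨N, A, hbox, hst⟩
    · rw [h0]
      exact ⟨by simp, by simp⟩
    obtain ⟨⟨x, v⟩, hs⟩ : ∃ q, s k = q := ⟨_, rfl⟩
    set r := max (U (x + v) - U x) 0 with hr
    have hr0 : 0 ≤ r := le_max_right _ _
    have hstep : ∀ e ∈ F, walkState U x₀ v₀ e (k + 1) =
        if A + r < e N then (((x + v, v), N), A + r) else (((x, -v), N + 1), 0) := by
      intro e he
      rw [walkState, hst e he, walkStep, hs]
    -- The two targets differ, so the next state reveals whether the clock survived.
    have hne : ((x, -v) : ℤ × ℤˣ) ≠ (x + v, v) := by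
      intro h
      rcases Int.units_eq_one_or v with h' | h' <;> simp [h'] at h
    rw [hs, walkTransition]
    by_cases h1 : s (k + 1) = (x + v, v)
    · have h2 : F ∩ {e | (walkState U x₀ v₀ e (k + 1)).1.1 = s (k + 1)} =
          F ∩ {e | A + r < e N} := by
        ext e
        refine and_congr_right fun he => ?_
        simp only [mem_ofPred_eq, hstep e he, h1]
        split_ifs with h <;> simp [h, hne]
      rw [if_pos h1, h2, walkAccept_eq, ← hr]
      obtain ⟨h3, h4⟩ := hbox.accept hr0
      refine ⟨.inr ⟨N, A + r, h3, fun e he => ?_⟩, h4⟩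
      rw [hstep e he.1, if_pos (show A + r < e N from he.2), h1]
    rw [if_neg h1]
    by_cases h1' : s (k + 1) = (x, -v)
    · have h2 : F ∩ {e | (walkState U x₀ v₀ e (k + 1)).1.1 = s (k + 1)} =
          F ∩ {e | ¬ A + r < e N} := by
        ext e
        refine and_congr_right fun he => ?_
        simp only [mem_ofPred_eq, hstep e he, h1']
        split_ifs with h <;> simp [h, hne.symm]
      rw [if_pos h1', h2, walkAccept_eq, ← hr]
      obtain ⟨h3, h4⟩ := hbox.reject hr0
      refine ⟨.inr ⟨N + 1, 0, h3, fun e he => ?_⟩, h4⟩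
      rw [hstep e he.1, if_neg (show ¬ A + r < e N from he.2), h1']
    · have h2 : F ∩ {e | (walkState U x₀ v₀ e (k + 1)).1.1 = s (k + 1)} = ∅ := by
        rw [eq_empty_iff_forall_notMem]
        rintro e ⟨he, he'⟩
        rw [mem_ofPred_eq, hstep e he] at he'
        split_ifs at he'
        · exact h1 he'.symm
        · exact h1' he'.symm
      rw [if_neg h1', h2]
      exact ⟨by simp, by simp⟩

theorem isZigZagWalk_walkState (U : ℤ → ℝ) (x₀ : ℤ) (v₀ : ℤˣ) :
    IsZigZagWalk clockMeasure U x₀ v₀ fun k e => (walkState U x₀ v₀ e k).1.1 where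
  measurable k := (measurable_walkState U x₀ v₀ k).fst.fst
  initial := .of_forall fun _ => rfl
  markov n s := (walkState_cylinder U x₀ v₀ s (n + 1)).2 n rfl

theorem preimage_singleton_eq_cylinder {Ω : Type*} (Z : ℕ → Ω → ℤ × ℤˣ) {n : ℕ}
    (u : Fin (n + 1) → ℤ × ℤˣ) : (fun ω (i : Fin (n + 1)) => Z i ω) ⁻¹' {u} =
      {ω | ∀ k ≤ n, Z k ω = if hk : k < n + 1 then u ⟨k, hk⟩ else (0, 1)} := by
  ext ω
  simp only [mem_preimage, mem_singleton_iff, mem_ofPred_eq, funext_iff]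
  refine ⟨fun h k hk => ?_, fun h i => ?_⟩
  · rw [dif_pos (Nat.lt_succ_of_le hk)]
    exact h ⟨k, Nat.lt_succ_of_le hk⟩
  · have := h i (Nat.le_of_lt_succ i.2)
    rwa [dif_pos i.2] at this

/-- The law of a Zig-Zag walk is determined by its initial condition. -/
theorem IsZigZagWalk.map_eq {Ω Ω' : Type*} [MeasurableSpace Ω] [MeasurableSpace Ω']
    {P : Measure Ω} {P' : Measure Ω'} [IsProbabilityMeasure P] [IsProbabilityMeasure P']
    {U : ℤ → ℝ} {x₀ : ℤ} {v₀ : ℤˣ} {Z : ℕ → Ω → ℤ × ℤˣ} {Z' : ℕ → Ω' → ℤ × ℤˣ}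
    (h : IsZigZagWalk P U x₀ v₀ Z) (h' : IsZigZagWalk P' U x₀ v₀ Z') :
    P.map (fun ω k => Z k ω) = P'.map (fun ω k => Z' k ω) := by
  have key : ∀ (n : ℕ) (s : ℕ → ℤ × ℤˣ),
      P.real {ω | ∀ k ≤ n, Z k ω = s k} = P'.real {ω | ∀ k ≤ n, Z' k ω = s k} := by
    intro n s
    induction n with
    | zero =>
      have h1 : P.real {ω | ∀ k ≤ 0, Z k ω = s k} = P.real {_ω | (x₀, v₀) = s 0} := by
        refine measureReal_congr ?_
        filter_upwards [h.initial] with ω hω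
        simp [Set.ofPred, hω]
      have h2 : P'.real {ω | ∀ k ≤ 0, Z' k ω = s k} = P'.real {_ω | (x₀, v₀) = s 0} := by
        refine measureReal_congr ?_
        filter_upwards [h'.initial] with ω hω
        simp [Set.ofPred, hω]
      rw [h1, h2]
      by_cases hs : (x₀, v₀) = s 0 <;> simp [hs]
    | succ n ih => rw [h.markov, h'.markov, ih]
  refine map_eq_of_forall_fin h.measurable h'.measurable fun n => ?_
  refine Measure.ext_of_singleton fun u => ?_
  have hm : Measurable fun ω (i : Fin (n + 1)) => Z i ω :=
    measurable_pi_lambda _ fun i => h.measurable _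
  have hm' : Measurable fun ω (i : Fin (n + 1)) => Z' i ω :=
    measurable_pi_lambda _ fun i => h'.measurable _
  rw [Measure.map_apply hm (measurableSet_singleton u),
    Measure.map_apply hm' (measurableSet_singleton u)]
  rw [preimage_singleton_eq_cylinder Z, preimage_singleton_eq_cylinder Z']
  have := key n fun k => if hk : k < n + 1 then u ⟨k, hk⟩ else (0, 1)
  rwa [measureReal_def, measureReal_def, ENNReal.toReal_eq_toReal_iff' (measure_ne_top _ _)
    (measure_ne_top _ _)] at this

/-! ### The jump times driven by exponential clocks -/

/-- Positions and times of the jumps of the Zig-Zag process driven by the clocks `e`. -/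
noncomputable def jumpState (H : ℝ → ℝ) (y₀ : ℝ) (w₀ : ℤˣ) (e : ℕ → ℝ) : ℕ → ℝ × ℝ≥0
  | 0 => (y₀, 0)
  | n + 1 =>
    ((jumpState H y₀ w₀ e n).1 +
      holdTime H (jumpState H y₀ w₀ e n).1 (flipVelocity w₀ n) (e n) * flipVelocity w₀ n,
    (jumpState H y₀ w₀ e n).2 + holdTime H (jumpState H y₀ w₀ e n).1 (flipVelocity w₀ n) (e n))

/-- The jump times of the Zig-Zag process driven by the clocks `e`. -/
noncomputable def clockJump (H : ℝ → ℝ) (y₀ : ℝ) (w₀ : ℤˣ) (e : ℕ → ℝ) (n : ℕ) : ℝ≥0 :=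
  (jumpState H y₀ w₀ e n).2

theorem jumpState_fst (H : ℝ → ℝ) (y₀ : ℝ) (w₀ : ℤˣ) (e : ℕ → ℝ) (n : ℕ) :
    (jumpState H y₀ w₀ e n).1 = jumpPos y₀ w₀ (clockJump H y₀ w₀ e) n := by
  induction n with
  | zero => rfl
  | succ n ih =>
    rw [jumpPos, ← ih]
    simp [clockJump, jumpState]

theorem clockJump_zero (H : ℝ → ℝ) (y₀ : ℝ) (w₀ : ℤˣ) (e : ℕ → ℝ) :
    clockJump H y₀ w₀ e 0 = 0 := rfl

theorem clockJump_succ (H : ℝ → ℝ) (y₀ : ℝ) (w₀ : ℤˣ) (e : ℕ → ℝ) (n : ℕ) :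
    clockJump H y₀ w₀ e (n + 1) = clockJump H y₀ w₀ e n +
      holdTime H (jumpPos y₀ w₀ (clockJump H y₀ w₀ e) n) (flipVelocity w₀ n) (e n) := by
  rw [← jumpState_fst]
  rfl

theorem jumpState_congr (H : ℝ → ℝ) (y₀ : ℝ) (w₀ : ℤˣ) {e e' : ℕ → ℝ} {n : ℕ}
    (h : ∀ i < n, e i = e' i) : jumpState H y₀ w₀ e n = jumpState H y₀ w₀ e' n := by
  induction n with
  | zero => rfl
  | succ n ih =>
    rw [jumpState, jumpState, ih fun i hi => h i (by omega), h n (by omega)]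

theorem abs_jumpPos_le (y₀ : ℝ) (w₀ : ℤˣ) {j : ℕ → ℝ≥0} (h0 : j 0 = 0) (hj : Monotone j) (n : ℕ) :
    |jumpPos y₀ w₀ j n| ≤ |y₀| + j n := by
  induction n with
  | zero => simp [jumpPos, h0]
  | succ n ih =>
    rw [jumpPos]
    refine (abs_add_le _ _).trans ?_
    have h1 : (j n : ℝ) ≤ j (n + 1) := by exact_mod_cast hj (Nat.le_succ n)
    rw [abs_mul, abs_flipVelocity, mul_one, abs_of_nonneg (sub_nonneg.2 h1)]
    linarith

/-- If the jump times stayed bounded, so would the positions, and the rate would be at most some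
`C`. Then `e n ≤ C * (j (n + 1) - j n)` would tend to `0`, while infinitely many clocks exceed `1`.
-/
theorem isJumpSeq_clockJump {H : ℝ → ℝ} (hH : Continuous (deriv H)) (hd : Differentiable ℝ H)
    (hHtop : Tendsto H (cocompact ℝ) atTop) (y₀ : ℝ) (w₀ : ℤˣ) {e : ℕ → ℝ} (he : ∀ n, 0 < e n)
    (he' : ∀ N, ∃ n ≥ N, 1 < e n) : IsJumpSeq (clockJump H y₀ w₀ e) := by
  set j := clockJump H y₀ w₀ e with hj
  have hlt : ∀ n, j n < j (n + 1) := fun n => by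
    rw [hj, clockJump_succ]
    exact lt_add_of_pos_right _
      (holdTime_pos hH hd hHtop _ _ _ (abs_flipVelocity w₀ n) (he n))
  have hmono : Monotone j := monotone_nat_of_le_succ fun n => (hlt n).le
  refine ⟨rfl, hlt, ?_⟩
  by_contra! hM
  obtain ⟨M, hM⟩ := hM
  have hM' : ∀ n, (j n : ℝ) ≤ M := fun n => by exact_mod_cast hM n
  have hlim := tendsto_atTop_ciSup hmono ⟨(M : ℝ≥0), by rintro _ ⟨n, rfl⟩; exact hM n⟩
  have hlim' : Tendsto (fun n => (j n : ℝ)) atTop (𝓝 ((⨆ n, j n : ℝ≥0) : ℝ)) :=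
    NNReal.tendsto_coe.2 hlim
  have hdiff : Tendsto (fun n => (j (n + 1) : ℝ) - j n) atTop (𝓝 0) := by
    simpa using ((tendsto_add_atTop_iff_nat 1).2 hlim').sub hlim'
  obtain ⟨C, hC⟩ := (isCompact_Icc (a := -(|y₀| + M)) (b := |y₀| + M)).exists_bound_of_continuousOn
    hH.continuousOn
  have hC0 : 0 ≤ C := (norm_nonneg _).trans (hC 0 ⟨neg_nonpos.2 (by positivity), by positivity⟩)
  have hle : ∀ n, e n ≤ C * ((j (n + 1) : ℝ) - j n) := by
    intro n
    have h1 := hazard_holdTime hH hd hHtop (jumpPos y₀ w₀ j n) (flipVelocity w₀ n) (e n)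
      (abs_flipVelocity w₀ n) (he n).le
    have h2 : (j (n + 1) : ℝ) - j n =
        holdTime H (jumpPos y₀ w₀ j n) (flipVelocity w₀ n) (e n) := by
      rw [hj, clockJump_succ, NNReal.coe_add, add_sub_cancel_left]
    rw [h2]
    refine h1.ge.trans (hazard_le_mul hH (NNReal.coe_nonneg _) fun s hs => ?_)
    have h3 : |jumpPos y₀ w₀ j n + s * flipVelocity w₀ n| ≤ |y₀| + M := by
      refine (abs_add_le _ _).trans ?_
      rw [abs_mul, abs_flipVelocity, mul_one, abs_of_nonneg hs.1]
      have h4 := abs_jumpPos_le y₀ w₀ (rfl : j 0 = 0) hmono n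
      have h5 := hs.2
      have h6 := hM' (n + 1)
      linarith
    refine max_le ((le_abs_self _).trans ?_) hC0
    rw [abs_mul, abs_flipVelocity, one_mul]
    exact hC _ (abs_le.1 h3)
  have hCdiff : Tendsto (fun n => C * ((j (n + 1) : ℝ) - j n)) atTop (𝓝 0) := by
    simpa using hdiff.const_mul C
  obtain ⟨N, hN⟩ := eventually_atTop.1 (hCdiff.eventually (gt_mem_nhds one_pos))
  obtain ⟨n, hn, hn'⟩ := he' N
  exact absurd (hn'.trans_le (hle n)) (not_lt.2 (hN n hn).le)

theorem ae_clock_pos : ∀ᵐ e ∂clockMeasure, ∀ n, 0 < e n := by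
  rw [ae_all_iff]
  intro n
  have h : ∀ᵐ x ∂(expMeasure 1), 0 < x := by
    change expMeasure 1 (Ioi 0)ᶜ = 0
    rw [prob_compl_eq_zero_iff measurableSet_Ioi, expMeasure_Ioi le_rfl]
    simp
  rw [← map_clockMeasure_eval n] at h
  exact ae_of_ae_map (measurable_pi_apply n).aemeasurable h

/-- The clocks from `N` to `N + k` are all at most `1` with probability `(1 - e⁻¹) ^ (k + 1)`, which
vanishes as `k` grows. -/
theorem ae_clock_frequently : ∀ᵐ e ∂clockMeasure, ∀ N, ∃ n ≥ N, 1 < e n := by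
  rw [ae_all_iff]
  intro N
  have hc : (expMeasure 1).real (Iic 1) = 1 - Real.exp (-1) := by
    rw [← compl_Ioi, probReal_compl_eq_one_sub measurableSet_Ioi, expMeasure_real_Ioi zero_le_one]
  have hlt : 1 - Real.exp (-1) < 1 := by linarith [Real.exp_pos (-1)]
  have h0 : 0 ≤ 1 - Real.exp (-1) := by
    have : Real.exp (-1) ≤ 1 := Real.exp_le_one_iff.2 (by norm_num)
    linarith
  have key : ∀ k : ℕ, clockMeasure.real {e | ¬ ∃ n ≥ N, 1 < e n} ≤ (1 - Real.exp (-1)) ^ (k + 1) := by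
    intro k
    let B : ℕ → Set ℝ := fun i => if i < N then univ else Iic 1
    have hB : ∀ i, MeasurableSet (B i) := fun i => by
      dsimp only [B]
      split_ifs
      · exact .univ
      · exact measurableSet_Iic
    have h1 : {e : ℕ → ℝ | ¬ ∃ n ≥ N, 1 < e n} ⊆ {e | ∀ i ≤ N + k, e i ∈ B i} := by
      intro e he i _
      simp only [mem_ofPred_eq, not_exists, not_and, not_lt] at he
      dsimp only [B]
      split_ifs with h
      · trivial
      · exact he i (not_lt.1 h)
    refine (measureReal_mono h1).trans (le_of_eq ?_)
    rw [clockMeasure_real_box _ hB, add_assoc, Finset.prod_range_add]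
    have h2 : ∏ i ∈ Finset.range N, (expMeasure 1).real (B i) = 1 :=
      Finset.prod_eq_one fun i hi => by simp [B, Finset.mem_range.1 hi]
    rw [h2, one_mul]
    simp [B, hc]
  have h1 : clockMeasure.real {e | ¬ ∃ n ≥ N, 1 < e n} ≤ 0 :=
    ge_of_tendsto' ((tendsto_add_atTop_iff_nat 1).2 (tendsto_pow_atTop_nhds_zero_of_lt_one h0 hlt))
      key
  exact (measureReal_eq_zero_iff).1 (le_antisymm h1 measureReal_nonneg)

theorem measurable_jumpState (hH : Continuous (deriv H)) (hd : Differentiable ℝ H)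
    (hHtop : Tendsto H (cocompact ℝ) atTop) (y₀ : ℝ) (w₀ : ℤˣ) (n : ℕ) :
    Measurable fun e => jumpState H y₀ w₀ e n := by
  induction n with
  | zero => exact measurable_const
  | succ n ih =>
    have h : Measurable fun e : ℕ → ℝ =>
        holdTime H (jumpState H y₀ w₀ e n).1 (flipVelocity w₀ n) (e n) :=
      (measurable_holdTime hH hd hHtop _ (abs_flipVelocity w₀ n)).comp
        (ih.fst.prodMk (measurable_pi_apply n))
    exact (ih.fst.add (h.coe_nnreal_real.mul_const _)).prodMk (ih.snd.add h)

theorem measurable_clockJump {H : ℝ → ℝ} (hH : Continuous (deriv H)) (hd : Differentiable ℝ H)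
    (hHtop : Tendsto H (cocompact ℝ) atTop) (y₀ : ℝ) (w₀ : ℤˣ) :
    Measurable (clockJump H y₀ w₀) :=
  measurable_pi_lambda _ fun n => (measurable_jumpState hH hd hHtop y₀ w₀ n).snd

/-- The position at the `n`-th jump depends on the earlier clocks only, so clock `n` is independent
of it; having no atoms, it almost surely avoids the given level. -/
theorem ae_hazard_ne {H : ℝ → ℝ} (hH : Continuous (deriv H)) (hd : Differentiable ℝ H)
    (hHtop : Tendsto H (cocompact ℝ) atTop) (y₀ : ℝ) (w₀ : ℤˣ) :
    ∀ᵐ e ∂clockMeasure, ∀ (n : ℕ) (q : ℚ),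
      hazard H (jumpPos y₀ w₀ (clockJump H y₀ w₀ e) n) (flipVelocity w₀ n) q ≠ e n := by
  rw [ae_all_iff]
  intro n
  rw [ae_all_iff]
  intro q
  have h1 := map_clockMeasure_prod (measurable_jumpState hH hd hHtop y₀ w₀ n).fst
    fun e e' h => by rw [jumpState_congr H y₀ w₀ h]
  have hm : Measurable fun y => hazard H y (flipVelocity w₀ n) q :=
    ((continuous_hazard hH (flipVelocity w₀ n)).comp
      (continuous_id.prodMk continuous_const)).measurable
  have h2 : ∀ᵐ p ∂(clockMeasure.map (fun e => (jumpState H y₀ w₀ e n).1)).prod (expMeasure 1),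
      hazard H p.1 (flipVelocity w₀ n) q ≠ p.2 := by
    refine (Measure.measure_prod_null ?_).2 (.of_forall fun y => ?_)
    · exact (measurableSet_eq_fun (hm.comp measurable_fst) measurable_snd).compl.compl
    · refine measure_mono_null (t := {hazard H y (flipVelocity w₀ n) q}) ?_ (measure_singleton _)
      intro x hx
      by_contra h
      exact hx (fun h' => h h'.symm)
  rw [← h1] at h2
  have h3 := ae_of_ae_map
    ((measurable_jumpState hH hd hHtop y₀ w₀ n).fst.prodMk (measurable_pi_apply n)).aemeasurable h2
  filter_upwards [h3] with e he
  rwa [jumpState_fst] at he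

/-! ### Uniqueness of the law of the Zig-Zag process -/

/-- The holding times are distributed as those of the Zig-Zag process started at `(y₀, w₀)`. -/
def HasHoldingLaw {Ω : Type*} [MeasurableSpace Ω] (P : Measure Ω) (H : ℝ → ℝ) (y₀ : ℝ) (w₀ : ℤˣ)
    (J : ℕ → Ω → ℝ≥0∞) : Prop :=
  ∀ (n : ℕ) (t : ℝ≥0) (B : Set (Fin (n + 1) → ℝ≥0∞)), MeasurableSet B →
    P {ω | (fun i : Fin (n + 1) => J i ω) ∈ B ∧ J n ω + t < J (n + 1) ω} =
      ∫⁻ ω in {ω | (fun i : Fin (n + 1) => J i ω) ∈ B ∧ J n ω < ∞},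
        ENNReal.ofReal (noJumpProb H (jumpPos y₀ w₀ (fun i => (J i ω).toNNReal) n)
          (flipVelocity w₀ n) t) ∂P

/-- The jumps up to index `n` are functions of the clocks before `n`. Conditionally on them,
`lt_holdTime_iff` turns the event into clock `n` exceeding the integrated rate, and Fubini applies.
-/
theorem hasHoldingLaw_clockJump {H : ℝ → ℝ} (hH : Continuous (deriv H)) (hd : Differentiable ℝ H)
    (hHtop : Tendsto H (cocompact ℝ) atTop) (y₀ : ℝ) (w₀ : ℤˣ) :
    HasHoldingLaw clockMeasure H y₀ w₀ fun n e => (clockJump H y₀ w₀ e n : ℝ≥0∞) := by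
  intro n t B hB
  have hw := abs_flipVelocity w₀ n
  let g : (ℕ → ℝ) → (Fin (n + 1) → ℝ≥0∞) × ℝ := fun e =>
    (fun i => (clockJump H y₀ w₀ e i : ℝ≥0∞), (jumpState H y₀ w₀ e n).1)
  have hF : Measurable fun e (i : Fin (n + 1)) => (clockJump H y₀ w₀ e i : ℝ≥0∞) :=
    measurable_pi_lambda _ fun i => (measurable_jumpState hH hd hHtop y₀ w₀ i).snd.coe_nnreal_ennreal
  have hg : Measurable g := hF.prodMk (measurable_jumpState hH hd hHtop y₀ w₀ n).fst
  have h1 := map_clockMeasure_prod (n := n) hg fun e e' h => by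
    refine Prod.ext (funext fun i => ?_) ?_
    · have : clockJump H y₀ w₀ e i = clockJump H y₀ w₀ e' i := by
        rw [clockJump, clockJump, jumpState_congr H y₀ w₀ fun k hk => h k (by omega)]
      exact congrArg _ this
    · exact congrArg Prod.fst (jumpState_congr H y₀ w₀ h)
  have hm : Measurable fun y => hazard H y (flipVelocity w₀ n) t :=
    ((continuous_hazard hH (flipVelocity w₀ n)).comp
      (continuous_id.prodMk continuous_const)).measurable
  let D : Set (((Fin (n + 1) → ℝ≥0∞) × ℝ) × ℝ) :=
    {p | p.1.1 ∈ B ∧ hazard H p.1.2 (flipVelocity w₀ n) t < p.2}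
  have hD : MeasurableSet D :=
    (measurable_fst.fst hB).inter (measurableSet_lt (hm.comp measurable_fst.snd) measurable_snd)
  have h2 : {e | (fun i : Fin (n + 1) => (clockJump H y₀ w₀ e i : ℝ≥0∞)) ∈ B ∧
      (clockJump H y₀ w₀ e n : ℝ≥0∞) + t < clockJump H y₀ w₀ e (n + 1)} =
      (fun e => (g e, e n)) ⁻¹' D := by
    ext e
    refine and_congr_right fun _ => ?_
    rw [clockJump_succ, ← jumpState_fst, ← ENNReal.coe_add, ENNReal.coe_lt_coe,
      add_lt_add_iff_left, lt_holdTime_iff hH hd hHtop _ _ _ hw]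
  have h3 : {e | (fun i : Fin (n + 1) => (clockJump H y₀ w₀ e i : ℝ≥0∞)) ∈ B ∧
      (clockJump H y₀ w₀ e n : ℝ≥0∞) < ∞} =
      (fun e (i : Fin (n + 1)) => (clockJump H y₀ w₀ e i : ℝ≥0∞)) ⁻¹' B := by
    ext e; simp
  rw [h2, h3, ← Measure.map_apply (hg.prodMk (measurable_pi_apply n)) hD, h1,
    Measure.prod_apply hD, lintegral_map (measurable_measure_prodMk_left hD) hg,
    ← lintegral_indicator (hF hB)]
  refine lintegral_congr fun e => ?_
  by_cases he : (fun i : Fin (n + 1) => (clockJump H y₀ w₀ e i : ℝ≥0∞)) ∈ B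
  · rw [indicator_of_mem (by exact he)]
    have h4 : Prod.mk (g e) ⁻¹' D = Ioi (hazard H (jumpState H y₀ w₀ e n).1 (flipVelocity w₀ n) t) := by
      ext x; simp [D, g, he]
    rw [h4, expMeasure_Ioi (hazard_nonneg _ _ t.coe_nonneg), noJumpProb_eq, jumpState_fst]
    simp
  · rw [indicator_of_notMem (by exact he)]
    have h4 : Prod.mk (g e) ⁻¹' D = ∅ := by
      ext x; simp [D, g, he]
    rw [h4, measure_empty]

/-- The total mass is a separate assumption because no half-line `Ioi t` sees an atom at `0`. -/
theorem measure_eq_of_Ioi {μ ν : Measure ℝ≥0∞} [IsFiniteMeasure μ]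
    (h : ∀ t : ℝ≥0, μ (Ioi (t : ℝ≥0∞)) = ν (Ioi (t : ℝ≥0∞))) (huniv : μ univ = ν univ) : μ = ν := by
  refine ext_of_generate_finite (range Ioi) ?_ isPiSystem_Ioi ?_ huniv
  · rw [← borel_eq_generateFrom_Ioi]
    exact BorelSpace.measurable_eq
  · rintro _ ⟨t, rfl⟩
    induction t with
    | top => simp
    | coe t => exact h t

/-- Extend a finite sequence of extended nonnegative reals to an infinite one. -/
noncomputable def extendFin {n : ℕ} (F : Fin (n + 1) → ℝ≥0∞) (i : ℕ) : ℝ≥0 :=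
  if hi : i < n + 1 then (F ⟨i, hi⟩).toNNReal else 0

theorem measurable_extendFin {n : ℕ} : Measurable (extendFin (n := n)) := by
  refine measurable_pi_lambda _ fun i => ?_
  unfold extendFin
  split_ifs
  · exact (measurable_pi_apply _).ennreal_toNNReal
  · exact measurable_const

/-- The right-hand side involves `J` only through the law of its first `n + 1` terms, which is what
an induction on `n` can use. -/
theorem HasHoldingLaw.measure_inter {Ω : Type*} [MeasurableSpace Ω] {P : Measure Ω} {H : ℝ → ℝ}
    {y₀ : ℝ} {w₀ : ℤˣ} {J : ℕ → Ω → ℝ≥0∞} (h : HasHoldingLaw P H y₀ w₀ J)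
    (hH : Continuous (deriv H)) (hJ : ∀ n, Measurable (J n)) {n : ℕ} {t : ℝ≥0}
    {B : Set (Fin (n + 1) → ℝ≥0∞)} (hB : MeasurableSet B) :
    P ((fun ω => J (n + 1) ω - J n ω) ⁻¹' Ioi (t : ℝ≥0∞) ∩
        (fun ω (i : Fin (n + 1)) => J i ω) ⁻¹' B) =
      ∫⁻ F in B ∩ {F | F (Fin.last n) < ∞},
        ENNReal.ofReal (noJumpProb H (jumpPos y₀ w₀ (extendFin F) n) (flipVelocity w₀ n) t)
          ∂(P.map fun ω (i : Fin (n + 1)) => J i ω) := by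
  have hG : Measurable fun F : Fin (n + 1) → ℝ≥0∞ =>
      ENNReal.ofReal (noJumpProb H (jumpPos y₀ w₀ (extendFin F) n) (flipVelocity w₀ n) t) := by
    have h1 : Continuous fun y => noJumpProb H y (flipVelocity w₀ n) t :=
      Real.continuous_exp.comp ((continuous_hazard hH (flipVelocity w₀ n)).comp
        (continuous_id.prodMk continuous_const)).neg
    exact (h1.measurable.comp
      ((continuous_jumpPos y₀ w₀ n).measurable.comp measurable_extendFin)).ennreal_ofReal
  have hF : Measurable fun ω (i : Fin (n + 1)) => J i ω := measurable_pi_lambda _ fun i => hJ i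
  have h1 : (fun ω => J (n + 1) ω - J n ω) ⁻¹' Ioi (t : ℝ≥0∞) ∩
      (fun ω (i : Fin (n + 1)) => J i ω) ⁻¹' B =
      {ω | (fun i : Fin (n + 1) => J i ω) ∈ B ∧ J n ω + t < J (n + 1) ω} := by
    ext ω
    simp only [mem_inter_iff, mem_preimage, mem_Ioi, lt_tsub_iff_left, mem_ofPred_eq]
    exact and_comm
  rw [h1, h n t B hB, setLIntegral_map (hB.inter (measurableSet_lt (measurable_pi_apply _)
    measurable_const)) hG hF]
  refine setLIntegral_congr_fun_ae ?_ (.of_forall fun ω _ => ?_)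
  · exact (hF hB).inter (measurableSet_lt (hJ n) measurable_const)
  · rw [jumpPos_congr y₀ w₀ fun i hi => ?_]
    rw [extendFin, dif_pos (Nat.lt_succ_of_le hi)]

/-- Given the law of the first jump times, the holding law fixes the joint law with the next
increment on rectangles, hence the law of one more jump time. -/
theorem HasHoldingLaw.map_fin_eq {Ω Ω' : Type*} [MeasurableSpace Ω] [MeasurableSpace Ω']
    {P : Measure Ω} {P' : Measure Ω'} [IsProbabilityMeasure P] [IsProbabilityMeasure P']
    {H : ℝ → ℝ} (hH : Continuous (deriv H)) {y₀ : ℝ} {w₀ : ℤˣ}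
    {J : ℕ → Ω → ℝ≥0∞} {J' : ℕ → Ω' → ℝ≥0∞} (hJ : ∀ n, Measurable (J n))
    (hJ' : ∀ n, Measurable (J' n)) (h0 : ∀ᵐ ω ∂P, J 0 ω = 0 ∧ Monotone fun n => J n ω)
    (h0' : ∀ᵐ ω ∂P', J' 0 ω = 0 ∧ Monotone fun n => J' n ω)
    (h : HasHoldingLaw P H y₀ w₀ J) (h' : HasHoldingLaw P' H y₀ w₀ J') (n : ℕ) :
    P.map (fun ω (i : Fin (n + 1)) => J i ω) = P'.map (fun ω (i : Fin (n + 1)) => J' i ω) := by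
  induction n with
  | zero =>
    have e1 : P.map (fun ω (i : Fin 1) => J i ω) = P.map fun _ _ => 0 := by
      refine Measure.map_congr ?_
      filter_upwards [h0] with ω hω
      funext i
      rw [Subsingleton.elim i 0]
      exact hω.1
    have e2 : P'.map (fun ω (i : Fin 1) => J' i ω) = P'.map fun _ _ => 0 := by
      refine Measure.map_congr ?_
      filter_upwards [h0'] with ω hω
      funext i
      rw [Subsingleton.elim i 0]
      exact hω.1
    rw [e1, e2]
    simp [Measure.map_const]
  | succ n ih =>
    have hF : Measurable fun ω (i : Fin (n + 1)) => J i ω := measurable_pi_lambda _ fun i => hJ i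
    have hF' : Measurable fun ω (i : Fin (n + 1)) => J' i ω := measurable_pi_lambda _ fun i => hJ' i
    have hΔ : Measurable fun ω => J (n + 1) ω - J n ω := (hJ _).sub (hJ _)
    have hΔ' : Measurable fun ω => J' (n + 1) ω - J' n ω := (hJ' _).sub (hJ' _)
    have hprod : P.map (fun ω => ((fun i : Fin (n + 1) => J i ω), J (n + 1) ω - J n ω)) =
        P'.map (fun ω => ((fun i : Fin (n + 1) => J' i ω), J' (n + 1) ω - J' n ω)) := by
      have : IsFiniteMeasure
        (P.map (fun ω => ((fun i : Fin (n + 1) => J i ω), J (n + 1) ω - J n ω))) := inferInstance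
      refine Measure.ext_prod fun {B} t hB ht => ?_
      rw [Measure.map_apply (hF.prodMk hΔ) (hB.prod ht),
        Measure.map_apply (hF'.prodMk hΔ') (hB.prod ht)]
      have key : (P.restrict ((fun ω (i : Fin (n + 1)) => J i ω) ⁻¹' B)).map
            (fun ω => J (n + 1) ω - J n ω) =
          (P'.restrict ((fun ω (i : Fin (n + 1)) => J' i ω) ⁻¹' B)).map
            (fun ω => J' (n + 1) ω - J' n ω) := by
        refine measure_eq_of_Ioi (fun t => ?_) ?_
        · rw [Measure.map_apply hΔ measurableSet_Ioi, Measure.map_apply hΔ' measurableSet_Ioi,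
            Measure.restrict_apply (hΔ measurableSet_Ioi),
            Measure.restrict_apply (hΔ' measurableSet_Ioi), h.measure_inter hH hJ hB,
            h'.measure_inter hH hJ' hB, ih]
        · rw [Measure.map_apply hΔ .univ, Measure.map_apply hΔ' .univ, preimage_univ, preimage_univ,
            Measure.restrict_apply_univ, Measure.restrict_apply_univ, ← Measure.map_apply hF hB,
            ← Measure.map_apply hF' hB, ih]
      have h2 := congrArg (fun m => m t) key
      rw [Measure.map_apply hΔ ht, Measure.map_apply hΔ' ht, Measure.restrict_apply (hΔ ht),
        Measure.restrict_apply (hΔ' ht)] at h2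
      rw [inter_comm, inter_comm (_ ⁻¹' t)] at h2
      exact h2
    let S : (Fin (n + 1) → ℝ≥0∞) × ℝ≥0∞ → Fin (n + 2) → ℝ≥0∞ := fun p i =>
      if hi : (i : ℕ) < n + 1 then p.1 ⟨i, hi⟩ else p.1 (Fin.last n) + p.2
    have hS : Measurable S := by
      refine measurable_pi_lambda _ fun i => ?_
      dsimp only [S]
      split_ifs
      · exact (measurable_pi_apply _).comp measurable_fst
      · exact ((measurable_pi_apply _).comp measurable_fst).add measurable_snd
    -- Monotonicity allows truncated subtraction to be undone, even at infinite jump times.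
    have hSJ : ∀ {J : ℕ → ℝ≥0∞}, Monotone J → (fun i : Fin (n + 2) => J i) =
        S ((fun i : Fin (n + 1) => J i), J (n + 1) - J n) := by
      intro J hJ
      funext i
      dsimp only [S]
      split_ifs with hi
      · rfl
      · have : (i : ℕ) = n + 1 := by omega
        rw [this, Fin.val_last, add_tsub_cancel_of_le (hJ (Nat.le_succ n))]
    have e1 : P.map (fun ω (i : Fin (n + 2)) => J i ω) =
        (P.map (fun ω => ((fun i : Fin (n + 1) => J i ω), J (n + 1) ω - J n ω))).map S := by
      rw [Measure.map_map hS (hF.prodMk hΔ)]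
      refine Measure.map_congr ?_
      filter_upwards [h0] with ω hω
      exact hSJ hω.2
    have e2 : P'.map (fun ω (i : Fin (n + 2)) => J' i ω) =
        (P'.map (fun ω => ((fun i : Fin (n + 1) => J' i ω), J' (n + 1) ω - J' n ω))).map S := by
      rw [Measure.map_map hS (hF'.prodMk hΔ')]
      refine Measure.map_congr ?_
      filter_upwards [h0'] with ω hω
      exact hSJ hω.2
    rw [e1, e2, hprod]

theorem ae_isJumpSeq_clockJump {H : ℝ → ℝ} (hH : Continuous (deriv H)) (hd : Differentiable ℝ H)
    (hHtop : Tendsto H (cocompact ℝ) atTop) (y₀ : ℝ) (w₀ : ℤˣ) :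
    ∀ᵐ e ∂clockMeasure, IsJumpSeq (clockJump H y₀ w₀ e) := by
  filter_upwards [ae_clock_pos, ae_clock_frequently] with e h1 h2
  exact isJumpSeq_clockJump hH hd hHtop y₀ w₀ h1 h2

/-- The law of a Zig-Zag process is that of the process driven by exponential clocks. -/
theorem IsZigZagProcess.map_eq {Ω : Type*} [MeasurableSpace Ω] {P : Measure Ω}
    [IsProbabilityMeasure P] {H : ℝ → ℝ} (hH : Continuous (deriv H)) (hd : Differentiable ℝ H)
    (hHtop : Tendsto H (cocompact ℝ) atTop) {y₀ : ℝ} {w₀ : ℤˣ} {Z : Ω → Cadlag (ℝ × ℝ)}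
    (hZ : IsZigZagProcess P H y₀ w₀ Z) :
    AEMeasurable Z P ∧
      P.map Z = clockMeasure.map fun e => zigzagPath y₀ w₀ (clockJump H y₀ w₀ e) := by
  obtain ⟨J, hJ, hJ0, hZ0, hpos, hvel, hlaw⟩ := hZ
  -- The positions at the jumps are functions of the jump times, so the holding law closes on `J`
  -- alone.
  have hposJ : ∀ᵐ ω ∂P, ∀ n, J n ω < ∞ →
      (Z ω (J n ω).toNNReal).1 = jumpPos y₀ w₀ (fun i => (J i ω).toNNReal) n := by
    filter_upwards [hJ0, hZ0, hpos] with ω h1 h2 h3 n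
    induction n with
    | zero => intro _; simpa [h1.1, jumpPos] using h2
    | succ n ih =>
      intro hn
      have hle : J n ω ≤ J (n + 1) ω := h1.2 (Nat.le_succ n)
      rw [h3 n (J (n + 1) ω).toNNReal (by rwa [ENNReal.coe_toNNReal hn.ne])
        (by rw [ENNReal.coe_toNNReal hn.ne]), ih (hle.trans_lt hn), jumpPos]
  have hlaw' : HasHoldingLaw P H y₀ w₀ J := by
    intro n t B hB
    rw [hlaw n t B hB]
    refine setLIntegral_congr_fun_ae ?_ ?_
    · exact (measurable_pi_lambda _ fun i => hJ _ : Measurable fun ω (i : Fin (n + 1)) => J i ω) hB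
        |>.inter (measurableSet_lt (hJ n) measurable_const)
    · filter_upwards [hposJ] with ω hω h
      rw [hω n h.2]
  have hcl : ∀ᵐ e ∂clockMeasure, (clockJump H y₀ w₀ e 0 : ℝ≥0∞) = 0 ∧
      Monotone fun n => (clockJump H y₀ w₀ e n : ℝ≥0∞) := by
    filter_upwards [ae_isJumpSeq_clockJump hH hd hHtop y₀ w₀] with e he
    exact ⟨by simp [clockJump_zero], fun m n hmn =>
      ENNReal.coe_le_coe.2 (he.strictMono.monotone hmn)⟩
  have hmap : P.map (fun ω n => J n ω) =
      clockMeasure.map fun e n => (clockJump H y₀ w₀ e n : ℝ≥0∞) := map_eq_of_forall_fin hJ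
    (fun n => (measurable_jumpState hH hd hHtop y₀ w₀ n).snd.coe_nnreal_ennreal)
    (HasHoldingLaw.map_fin_eq hH hJ
      (fun n => (measurable_jumpState hH hd hHtop y₀ w₀ n).snd.coe_nnreal_ennreal) hJ0 hcl hlaw'
      (hasHoldingLaw_clockJump hH hd hHtop y₀ w₀))
  have hJm : Measurable fun ω n => J n ω := measurable_pi_lambda _ hJ
  have hcm : Measurable fun e n => (clockJump H y₀ w₀ e n : ℝ≥0∞) :=
    measurable_pi_lambda _ fun n => (measurable_jumpState hH hd hHtop y₀ w₀ n).snd.coe_nnreal_ennreal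
  have hT : Measurable fun (j : ℕ → ℝ≥0∞) n => (j n).toNNReal :=
    measurable_pi_lambda _ fun n => (measurable_pi_apply n).ennreal_toNNReal
  -- Finite, strictly increasing and unbounded jump times are not part of the definition of the
  -- process; they are inherited from the clock construction through equality of laws.
  have hgood : ∀ᵐ ω ∂P, (∀ n, J n ω ≠ ∞) ∧ IsJumpSeq fun n => (J n ω).toNNReal := by
    have hset : MeasurableSet {j : ℕ → ℝ≥0∞ | (∀ n, j n ≠ ∞) ∧ IsJumpSeq fun n => (j n).toNNReal} := by
      rw [ofPred_and, ofPred_forall]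
      refine .inter (.iInter fun n => ?_) (hT measurableSet_isJumpSeq)
      have hn : Measurable fun j : ℕ → ℝ≥0∞ => j n := measurable_pi_apply n
      exact (hn (measurableSet_singleton (∞ : ℝ≥0∞))).compl
    refine ae_of_ae_map (p := fun j => (∀ n, j n ≠ ∞) ∧ IsJumpSeq fun n => (j n).toNNReal)
      hJm.aemeasurable ?_
    rw [hmap]
    refine (ae_map_iff hcm.aemeasurable hset).2 ?_
    filter_upwards [ae_isJumpSeq_clockJump hH hd hHtop y₀ w₀] with e he
    exact ⟨fun n => ENNReal.coe_ne_top, he⟩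
  -- The process is thus almost surely a measurable function of its jump times, which gives both its
  -- measurability and its law.
  have hZJ : Z =ᵐ[P] fun ω => zigzagPath y₀ w₀ fun n => (J n ω).toNNReal := by
    filter_upwards [hgood, hposJ, hpos, hvel] with ω h1 h2 h3 h4
    refine Cadlag.ext_of_forall fun t => ?_
    obtain ⟨n, hn1, hn2⟩ := h1.2.exists_index t
    rw [zigzagPath_apply y₀ w₀ h1.2 hn1 hn2]
    have e1 : J n ω ≤ t := by
      rw [← ENNReal.coe_toNNReal (h1.1 n)]; exact ENNReal.coe_le_coe.2 hn1
    have e2 : (t : ℝ≥0∞) < J (n + 1) ω := by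
      rw [← ENNReal.coe_toNNReal (h1.1 (n + 1))]; exact ENNReal.coe_lt_coe.2 hn2
    refine Prod.ext ?_ (h4 n t e1 e2)
    rw [h3 n t e1 e2.le, h2 n (lt_top_iff_ne_top.2 (h1.1 n))]
  have hm := (measurable_zigzagPath y₀ w₀).comp hT
  refine ⟨(hm.comp hJm).aemeasurable.congr hZJ.symm, ?_⟩
  rw [Measure.map_congr hZJ]
  have e1 := congrArg (Measure.map ((zigzagPath y₀ w₀) ∘ fun (j : ℕ → ℝ≥0∞) n => (j n).toNNReal)) hmap
  rw [Measure.map_map hm hJm, Measure.map_map hm hcm] at e1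
  exact e1

/-! ### Pathwise convergence -/

/-- The position of the walk driven by the clocks `e` just after its `n`-th flip, and the time of
this flip. -/
noncomputable def flipState (U : ℤ → ℝ) (x₀ : ℤ) (v₀ : ℤˣ) (e : ℕ → ℝ) : ℕ → ℤ × ℕ
  | 0 => (x₀, 0)
  | n + 1 =>
    ((flipState U x₀ v₀ e n).1 +
      moveCount U (flipState U x₀ v₀ e n).1 ((-1) ^ n * v₀) (e n) * ((-1) ^ n * v₀ : ℤˣ),
    (flipState U x₀ v₀ e n).2 +
      moveCount U (flipState U x₀ v₀ e n).1 ((-1) ^ n * v₀) (e n) + 1)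

/-- Explicit form of the driven walk between two flips: it moves in a straight line until the next
move would exhaust the clock. -/
theorem walkState_flipState_add {H : ℝ → ℝ} (hHtop : Tendsto H (cocompact ℝ) atTop) {ε : ℝ}
    (hε : 0 < ε) {U : ℤ → ℝ} (hU : U = fun k : ℤ => H (ε * k)) (x₀ : ℤ) (v₀ : ℤˣ) {e : ℕ → ℝ}
    (he : ∀ n, 0 < e n) (n i : ℕ)
    (hi : i ≤ moveCount U (flipState U x₀ v₀ e n).1 ((-1) ^ n * v₀) (e n)) :
    walkState U x₀ v₀ e ((flipState U x₀ v₀ e n).2 + i) =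
      ((((flipState U x₀ v₀ e n).1 + i * ((-1) ^ n * v₀ : ℤˣ), (-1) ^ n * v₀), n),
        walkHazard U (flipState U x₀ v₀ e n).1 ((-1) ^ n * v₀) i) := by
  induction n generalizing i with
  | zero =>
    induction i with
    | zero => simp [flipState, walkState, walkHazard]
    | succ i ih =>
      rw [← add_assoc, walkState, ih (by omega), walkStep]
      have h1 := walkHazard_lt_of_le_moveCount (he 0) hi
      rw [walkHazard_succ] at h1 ⊢
      simp only [add_mul, one_mul, Nat.cast_add, Nat.cast_one, ← add_assoc] at h1 ⊢
      rw [if_pos h1]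
  | succ n ihn =>
    induction i with
    | zero =>
      -- The final `+ 1` is the rejected move, during which the walk stays in place and flips.
      have h1 : (flipState U x₀ v₀ e (n + 1)).2 + 0 = (flipState U x₀ v₀ e n).2 +
          moveCount U (flipState U x₀ v₀ e n).1 ((-1) ^ n * v₀) (e n) + 1 := rfl
      rw [h1, walkState, ihn _ le_rfl, walkStep]
      have h2 : e n ≤ walkHazard U (flipState U x₀ v₀ e n).1 ((-1) ^ n * v₀)
          (moveCount U (flipState U x₀ v₀ e n).1 ((-1) ^ n * v₀) (e n) + 1) := by
        rw [hU]
        exact le_walkHazard_moveCount hHtop hε _ _ _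
      rw [walkHazard_succ] at h2
      simp only [add_mul, one_mul, ← add_assoc] at h2
      rw [if_neg (not_lt.2 h2)]
      simp [flipState, walkHazard, pow_succ]
    | succ i ih =>
      rw [← add_assoc, walkState, ih (by omega), walkStep]
      have h1 := walkHazard_lt_of_le_moveCount (he (n + 1)) hi
      rw [walkHazard_succ] at h1 ⊢
      simp only [add_mul, one_mul, Nat.cast_add, Nat.cast_one, ← add_assoc] at h1 ⊢
      rw [if_pos h1]

theorem tendsto_flipState {H : ℝ → ℝ} (hH : Continuous (deriv H)) (hd : Differentiable ℝ H)
    (hHtop : Tendsto H (cocompact ℝ) atTop) {ι : Type*} {l : Filter ι} {ε : ι → ℝ}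
    (hε0 : ∀ i, 0 < ε i) (hε : Tendsto ε l (𝓝 0)) {x₀ : ι → ℤ} {y₀ : ℝ}
    (hx : Tendsto (fun i => ε i * x₀ i) l (𝓝 y₀)) (v₀ : ℤˣ) {e : ℕ → ℝ} (he : ∀ n, 0 < e n)
    (hne : ∀ (n : ℕ) (q : ℚ),
      hazard H (jumpPos y₀ v₀ (clockJump H y₀ v₀ e) n) (flipVelocity v₀ n) q ≠ e n) (n : ℕ) :
    Tendsto (fun i => ε i * (flipState (fun k : ℤ => H (ε i * k)) (x₀ i) v₀ e n).1) l
        (𝓝 (jumpPos y₀ v₀ (clockJump H y₀ v₀ e) n)) ∧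
      Tendsto (fun i => ε i * (flipState (fun k : ℤ => H (ε i * k)) (x₀ i) v₀ e n).2) l
        (𝓝 (clockJump H y₀ v₀ e n)) := by
  induction n with
  | zero => exact ⟨hx, by simpa [flipState, clockJump_zero] using tendsto_const_nhds⟩
  | succ n ih =>
    have h1 := tendsto_moveCount hH hd hHtop hε0 hε ih.1 ((-1) ^ n * v₀) (he n) (hne n)
    have h2 : Tendsto (fun _ : ι => flipVelocity v₀ n) l (𝓝 (flipVelocity v₀ n)) :=
      tendsto_const_nhds
    constructor
    · rw [jumpPos, clockJump_succ, NNReal.coe_add, add_sub_cancel_left]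
      refine (ih.1.add (h1.mul h2)).congr fun i => ?_
      simp only [flipState, flipVelocity]
      push_cast
      ring
    · rw [clockJump_succ, NNReal.coe_add]
      -- The rejected move takes one unit of time, that is `ε` after rescaling, and disappears in
      -- the limit.
      have h3 := (ih.2.add h1).add hε
      rw [add_zero] at h3
      refine h3.congr fun i => ?_
      simp only [flipState]
      push_cast
      ring

/-- The rescaled walk and the Zig-Zag process driven by the same clocks are close. -/
theorem tendsto_scaledPath_walkState {H : ℝ → ℝ} (hH : Continuous (deriv H))
    (hd : Differentiable ℝ H) (hHtop : Tendsto H (cocompact ℝ) atTop) {x₀ : Ioi (0 : ℝ) → ℤ}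
    {y₀ : ℝ} (hx : Tendsto (fun ε : Ioi (0 : ℝ) => (ε : ℝ) * (x₀ ε : ℝ))
      (comap Subtype.val (𝓝 (0 : ℝ))) (𝓝 y₀)) (v₀ : ℤˣ) {e : ℕ → ℝ} (he : ∀ n, 0 < e n)
    (hj : IsJumpSeq (clockJump H y₀ v₀ e))
    (hne : ∀ (n : ℕ) (q : ℚ),
      hazard H (jumpPos y₀ v₀ (clockJump H y₀ v₀ e) n) (flipVelocity v₀ n) q ≠ e n) :
    Tendsto (fun ε : Ioi (0 : ℝ) => scaledPath ε.2 fun k =>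
        (walkState (fun k : ℤ => H ((ε : ℝ) * (k : ℝ))) (x₀ ε) v₀ e k).1.1)
      (comap Subtype.val (𝓝 (0 : ℝ))) (𝓝 (zigzagPath y₀ v₀ (clockJump H y₀ v₀ e))) := by
  have hε : Tendsto (fun ε : Ioi (0 : ℝ) => (ε : ℝ)) (comap Subtype.val (𝓝 (0 : ℝ))) (𝓝 0) :=
    tendsto_comap
  have hlim := tendsto_flipState hH hd hHtop (fun ε : Ioi (0 : ℝ) => ε.2) hε hx v₀ he hne
  refine tendsto_zigzagPath hj
    (a := fun ε n => Real.toNNReal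
      ((ε : ℝ) * (flipState (fun k : ℤ => H ((ε : ℝ) * k)) (x₀ ε) v₀ e n).2))
    (p := fun ε n => (ε : ℝ) * (flipState (fun k : ℤ => H ((ε : ℝ) * k)) (x₀ ε) v₀ e n).1)
    (.of_forall fun ε => by simp [flipState]) (fun n => ?_) (fun n => (hlim n).1) hε
    (.of_forall fun ε n t h1 h2 => ?_)
  · simpa using tendsto_real_toNNReal (hlim n).2
  · have hε0 : (0 : ℝ) < ε := ε.2
    set U : ℤ → ℝ := fun k : ℤ => H ((ε : ℝ) * k) with hU
    have hnn : ∀ m : ℕ, 0 ≤ (ε : ℝ) * m := fun m => by positivity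
    rw [Real.toNNReal_le_iff_le_coe] at h1
    rw [Real.lt_toNNReal_iff_coe_lt] at h2
    rw [Real.coe_toNNReal _ (hnn _)]
    set k := ⌊(t : ℝ) / ε⌋₊ with hk
    have hk1 : (flipState U (x₀ ε) v₀ e n).2 ≤ k := by
      rw [hk, Nat.le_floor_iff (by positivity), le_div_iff₀ hε0, mul_comm]
      exact h1
    have hk2 : k < (flipState U (x₀ ε) v₀ e (n + 1)).2 := by
      rw [hk, Nat.floor_lt (by positivity), div_lt_iff₀ hε0, mul_comm]
      exact h2
    obtain ⟨i, hi⟩ := Nat.exists_eq_add_of_le hk1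
    have him : i ≤ moveCount U (flipState U (x₀ ε) v₀ e n).1 ((-1) ^ n * v₀) (e n) := by
      rw [flipState] at hk2
      omega
    have hZ := walkState_flipState_add hHtop hε0 hU (x₀ ε) v₀ he n i him
    have hpath : (scaledPath ε.2 fun k => (walkState U (x₀ ε) v₀ e k).1.1) t =
        ((ε : ℝ) * (((flipState U (x₀ ε) v₀ e n).1 + i * ((-1) ^ n * v₀ : ℤˣ) : ℤ) : ℝ),
          flipVelocity v₀ n) := by
      change (((ε : ℝ) * ((walkState U (x₀ ε) v₀ e k).1.1.1 : ℝ),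
        (((walkState U (x₀ ε) v₀ e k).1.1.2 : ℤ) : ℝ)) : ℝ × ℝ) = _
      rw [hi, hZ]
      rfl
    rw [hpath]
    refine ⟨?_, rfl⟩
    -- The only deviation from linear motion is the rounding of `t` to a multiple of `ε`, so `r = ε`
    -- works.
    have h3 : (ε : ℝ) * (((flipState U (x₀ ε) v₀ e n).1 + i * ((-1) ^ n * v₀ : ℤˣ) : ℤ) : ℝ) -
        ((ε : ℝ) * (flipState U (x₀ ε) v₀ e n).1 +
          ((t : ℝ) - ε * (flipState U (x₀ ε) v₀ e n).2) * flipVelocity v₀ n) =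
        (ε * k - t) * flipVelocity v₀ n := by
      rw [hi, flipVelocity]
      push_cast
      ring
    rw [h3, abs_mul, abs_flipVelocity, mul_one, abs_le]
    have h4 := Nat.lt_floor_add_one ((t : ℝ) / ε)
    have h5 := Nat.floor_le (div_nonneg t.coe_nonneg hε0.le)
    rw [div_lt_iff₀ hε0, ← hk] at h4
    rw [le_div_iff₀ hε0, ← hk] at h5
    constructor <;> linarith

/-! ### From pathwise convergence to convergence in law. -/

theorem measurable_scaledPath {ε : ℝ} (hε : 0 < ε) :
    Measurable (scaledPath hε : (ℕ → ℤ × ℤˣ) → Cadlag (ℝ × ℝ)) := by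
  refine (Cadlag.continuous_ofSeq hε).measurable.comp (measurable_pi_lambda _ fun k => ?_)
  exact (measurable_of_countable fun q : ℤ × ℤˣ => (ε * (q.1 : ℝ), ((q.2 : ℤ) : ℝ))).comp
    (measurable_pi_apply k)

theorem mainTheorem6
    (H : ℝ → ℝ) (hH : ContDiff ℝ 2 H) (hH_top : Tendsto H (cocompact ℝ) atTop)
    (x₀ : Ioi (0 : ℝ) → ℤ) (v₀ : ℤˣ) (xStar : ℝ)
    (hx₀ : Tendsto (fun ε : Ioi (0 : ℝ) => (ε : ℝ) * (x₀ ε : ℝ))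
      (comap Subtype.val (𝓝 (0 : ℝ))) (𝓝 xStar))
    {Ω : Ioi (0 : ℝ) → Type*} [∀ ε, MeasurableSpace (Ω ε)]
    (P : ∀ ε, Measure (Ω ε)) [∀ ε, IsProbabilityMeasure (P ε)]
    (XV : ∀ ε, ℕ → Ω ε → ℤ × ℤˣ)
    (hXV : ∀ ε : Ioi (0 : ℝ),
      IsZigZagWalk (P ε) (fun k : ℤ => H ((ε : ℝ) * (k : ℝ))) (x₀ ε) v₀ (XV ε))
    {Ω' : Type*} [MeasurableSpace Ω'] (P' : Measure Ω') [IsProbabilityMeasure P']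
    (YW : Ω' → Cadlag (ℝ × ℝ)) (hYW : IsZigZagProcess P' H xStar v₀ YW) :
    TendstoInDistribution
      (fun (ε : Ioi (0 : ℝ)) (ω : Ω ε) => scaledPath ε.2 (fun k => XV ε k ω))
      (comap Subtype.val (𝓝 (0 : ℝ))) YW P P' := by
  have hd : Differentiable ℝ H := hH.differentiable two_ne_zero
  have hH' : Continuous (deriv H) := hH.continuous_deriv one_le_two
  obtain ⟨hYm, hYlaw⟩ := hYW.map_eq hH' hd hH_top
  have hXm : ∀ ε, Measurable fun ω k => XV ε k ω := fun ε =>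
    measurable_pi_lambda _ (hXV ε).measurable
  have hwm : ∀ ε : Ioi (0 : ℝ), Measurable fun e k =>
      (walkState (fun k : ℤ => H ((ε : ℝ) * (k : ℝ))) (x₀ ε) v₀ e k).1.1 := fun ε =>
    measurable_pi_lambda _ fun k => (measurable_walkState _ _ _ k).fst.fst
  have hXlaw : ∀ ε : Ioi (0 : ℝ), (P ε).map (fun ω => scaledPath ε.2 (fun k => XV ε k ω)) =
      clockMeasure.map fun e => scaledPath ε.2 fun k =>
        (walkState (fun k : ℤ => H ((ε : ℝ) * (k : ℝ))) (x₀ ε) v₀ e k).1.1 := by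
    intro ε
    have h1 := congrArg (Measure.map (scaledPath ε.2))
      ((hXV ε).map_eq (isZigZagWalk_walkState _ (x₀ ε) v₀))
    rw [Measure.map_map (measurable_scaledPath ε.2) (hXm ε),
      Measure.map_map (measurable_scaledPath ε.2) (hwm ε)] at h1
    exact h1
  refine ⟨fun ε => ((measurable_scaledPath ε.2).comp (hXm ε)).aemeasurable, hYm, ?_⟩
  refine ProbabilityMeasure.tendsto_iff_forall_integral_tendsto.2 fun f => ?_
  have hlimm : Measurable fun e => zigzagPath xStar v₀ (clockJump H xStar v₀ e) :=
    (measurable_zigzagPath xStar v₀).comp (measurable_clockJump hH' hd hH_top xStar v₀)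
  have hX : ∀ ε : Ioi (0 : ℝ),
      ∫ x, f x ∂((P ε).map fun ω => scaledPath ε.2 (fun k => XV ε k ω)) =
        ∫ e, f (scaledPath ε.2 fun k =>
          (walkState (fun k : ℤ => H ((ε : ℝ) * (k : ℝ))) (x₀ ε) v₀ e k).1.1) ∂clockMeasure :=
    fun ε => by
      rw [hXlaw ε]
      exact integral_map ((measurable_scaledPath ε.2).comp (hwm ε)).aemeasurable
        f.continuous.aestronglyMeasurable
  have hY : ∫ x, f x ∂(P'.map YW) =
      ∫ e, f (zigzagPath xStar v₀ (clockJump H xStar v₀ e)) ∂clockMeasure := by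
    rw [hYlaw]
    exact integral_map hlimm.aemeasurable f.continuous.aestronglyMeasurable
  -- Both expectations are now integrals over the same clocks, so almost sure convergence and the
  -- bound `‖f‖` suffice.
  suffices h : Tendsto (fun ε : Ioi (0 : ℝ) => ∫ e, f (scaledPath ε.2 fun k =>
      (walkState (fun k : ℤ => H ((ε : ℝ) * (k : ℝ))) (x₀ ε) v₀ e k).1.1) ∂clockMeasure)
      (comap Subtype.val (𝓝 (0 : ℝ)))
      (𝓝 (∫ e, f (zigzagPath xStar v₀ (clockJump H xStar v₀ e)) ∂clockMeasure)) from
    (hY ▸ h).congr fun ε => (hX ε).symm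
  refine tendsto_integral_filter_of_dominated_convergence (fun _ => ‖f‖) ?_ ?_
    (integrable_const _) ?_
  · exact .of_forall fun ε => (f.continuous.measurable.comp
      ((measurable_scaledPath ε.2).comp (hwm ε))).aestronglyMeasurable
  · exact .of_forall fun ε => .of_forall fun e => f.norm_coe_le_norm _
  · filter_upwards [ae_clock_pos, ae_isJumpSeq_clockJump hH' hd hH_top xStar v₀,
      ae_hazard_ne hH' hd hH_top xStar v₀] with e h1 h2 h3
    exact (f.continuous.tendsto _).comp
      (tendsto_scaledPath_walkState hH' hd hH_top hx₀ v₀ h1 h2 h3)
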